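/- Let $\Omega\subset\mathbb{R}^3$ be a non-empty bounded open set (for instance a connected one with $C^2$ boundary). Let $\mu>0$ and $\lambda\in\mathbb{R}$ with $3\lambda+2\mu>0$, put $m=\min\{\mu,3\lambda+2\mu\}$, and let $\Delta^*u=\mu\Delta u+(\lambda+\mu)\nabla(\nabla\cdot u)$ be the Lamé operator. Let $\rho\in L^\infty(\Omega)$ be real valued and positive almost everywhere, with (essential) infimum $\rho_*=\inf_\Omega\rho$ and (essential) supremum $\rho^*=\sup_\Omega\rho$. Let $H^1_0(\Omega)$ and $H^2_0(\Omega)$ be the closures of $C_c^\infty(\Omega)$ in the complex Sobolev spaces $H^1(\Omega)$ and $H^2(\Omega)$; $(H^2_0(\Omega))^3$ carries the full $H^2$ norm. Let $\lambda_1(\Omega)$ be the smallest Dirichlet eigenvalue of $-\Delta$ in $\Omega$, i.e. the smallest real $\Lambda$ for which some $0\ne w\in H^1_0(\Omega)$ satisfies $\int_\Omega\nabla w\cdot\nabla\overline v\,dx=\Lambda\int_\Omega w\,\overline v\,dx$ for all $v\in H^1_0(\Omega)$. For $\omega\in\mathbb{R}$ and $u,h\in(H^2_0(\Omega))^3$ let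 $$a(u,h)=\int_\Omega(1-\rho)^{-1}(\Delta^*+\omega^2)u\cdot(\Delta^*+\omega^2)\overline h\,dx+\omega^2\int_\Omega\nabla u:\mathbb{C}:\nabla\overline h\,dx-\omega^4\int_\Omega u\cdot\overline h\,dx,$$ where $\nabla u:\mathbb{C}:\nabla\overline h=\sum_{i,j,k,l}\partial_ju_i\,C_{ijkl}\,\partial_l\overline{h_k}$ and $C_{ijkl}=\lambda\delta_{ij}\delta_{kl}+\mu(\delta_{ik}\delta_{jl}+\delta_{il}\delta_{jk})$. Suppose that $$0<\omega^2<\min\Big\{\frac{m\,\lambda_1(\Omega)}{\rho^*},\;m\,\lambda_1(\Omega)\Big\}.$$ Then $a(u,u)$ is coercive on $(H^2_0(\Omega))^3$ whenever $\rho_*>1$ or $\rho^*<1$, in the following sense. If $\rho_*>1$, there is a constant $C>0$ such that for all $u\in(H^2_0(\Omega))^3$ the number $a(u,u)$ is real and $-a(u,u)\ge C\|u\|^2_{H^2(\Omega)}$. If $\rho^*<1$, there is a constant $C>0$ such that for all $u\in(H^2_0(\Omega))^3$ the number $a(u,u)$ is real and $a(u,u)\ge C\|u\|^2_{H^2(\Omega)}$.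 -/

import Mathlib

open MeasureTheory
open scoped ComplexConjugate

noncomputable section

namespace ElasticITP

/-- Three-dimensional Euclidean space. -/
abbrev E3 : Type := EuclideanSpace ℝ (Fin 3)

/-- Classical partial derivative `∂φ/∂xᵢ`. -/
def classicalPartial (i : Fin 3) (φ : E3 → ℂ) (x : E3) : ℂ :=
  fderiv ℝ φ x (EuclideanSpace.single i 1)

/-- `φ ∈ C_c^∞(Ω)`: smooth, with compact support contained in `Ω`. -/
def IsTestFunction (Ω : Set E3) (φ : E3 → ℂ) : Prop :=
  ContDiff ℝ (⊤ : ℕ∞) φ ∧ HasCompactSupport φ ∧ tsupport φ ⊆ Ω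

/-- `g` is a weak (distributional) partial derivative `∂u/∂xᵢ` on `Ω`. -/
def HasWeakPartial (Ω : Set E3) (i : Fin 3) (u g : E3 → ℂ) : Prop :=
  LocallyIntegrableOn u Ω volume ∧ LocallyIntegrableOn g Ω volume ∧
    ∀ φ : E3 → ℂ, IsTestFunction Ω φ →
      ∫ x in Ω, u x * classicalPartial i φ x = - ∫ x in Ω, g x * φ x

open Classical in
/-- The weak partial derivative `∂u/∂xᵢ` on `Ω`; on an open set it is unique up to null sets.
It is set to `0` when `u` has none. -/
def weakPartial (Ω : Set E3) (i : Fin 3) (u : E3 → ℂ) : E3 → ℂ :=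
  if h : ∃ g : E3 → ℂ, HasWeakPartial Ω i u g then h.choose else 0

/-- `u ∈ L²(Ω)`. -/
def MemL2 (Ω : Set E3) (u : E3 → ℂ) : Prop :=
  MemLp u 2 (volume.restrict Ω)

/-- `u ∈ H¹(Ω)`. -/
def MemH1 (Ω : Set E3) (u : E3 → ℂ) : Prop :=
  MemL2 Ω u ∧ ∀ i, ∃ g : E3 → ℂ, MemL2 Ω g ∧ HasWeakPartial Ω i u g

/-- `u ∈ H²(Ω)`. -/
def MemH2 (Ω : Set E3) (u : E3 → ℂ) : Prop :=
  MemH1 Ω u ∧ ∀ i, MemH1 Ω (weakPartial Ω i u)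

/-- `‖u‖²` in `L²(Ω)`. -/
def l2NormSq (Ω : Set E3) (u : E3 → ℂ) : ℝ :=
  ∫ x in Ω, ‖u x‖ ^ 2

/-- `‖u‖²` in `H¹(Ω)`. -/
def h1NormSq (Ω : Set E3) (u : E3 → ℂ) : ℝ :=
  l2NormSq Ω u + ∑ i, l2NormSq Ω (weakPartial Ω i u)

/-- `‖u‖²` in `H²(Ω)`. -/
def h2NormSq (Ω : Set E3) (u : E3 → ℂ) : ℝ :=
  l2NormSq Ω u + ∑ i, l2NormSq Ω (weakPartial Ω i u)
    + ∑ i, ∑ j, l2NormSq Ω (weakPartial Ω i (weakPartial Ω j u))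

/-- `u ∈ H¹₀(Ω)`: the closure of `C_c^∞(Ω)` in `H¹(Ω)`. -/
def MemH10 (Ω : Set E3) (u : E3 → ℂ) : Prop :=
  MemH1 Ω u ∧ ∀ ε : ℝ, 0 < ε → ∃ φ, IsTestFunction Ω φ ∧ h1NormSq Ω (u - φ) < ε

/-- `u ∈ H²₀(Ω)`: the closure of `C_c^∞(Ω)` in `H²(Ω)`. -/
def MemH20 (Ω : Set E3) (u : E3 → ℂ) : Prop :=
  MemH2 Ω u ∧ ∀ ε : ℝ, 0 < ε → ∃ φ, IsTestFunction Ω φ ∧ h2NormSq Ω (u - φ) < ε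

/-- `Λ` is an eigenvalue of `-Δ` on `Ω` with Dirichlet boundary condition (weak formulation):
`-Δ w = Λ w` in `Ω`, `w ∈ H¹₀(Ω)`, `w ≠ 0`. -/
def IsDirichletEigenvalue (Ω : Set E3) (Λ : ℝ) : Prop :=
  ∃ w : E3 → ℂ, MemH10 Ω w ∧ ¬ (w =ᵐ[volume.restrict Ω] 0) ∧
    ∀ v : E3 → ℂ, MemH10 Ω v →
      ∫ x in Ω, ∑ i, weakPartial Ω i w x * conj (weakPartial Ω i v x)
        = (Λ : ℂ) * ∫ x in Ω, w x * conj (v x)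

/-- The first (smallest) Dirichlet eigenvalue `λ₁(Ω)` of `-Δ` in `Ω`. -/
def firstDirichletEigenvalue (Ω : Set E3) : ℝ :=
  sInf {Λ : ℝ | IsDirichletEigenvalue Ω Λ}

/-- A vector field with three complex components. -/
abbrev VField : Type := Fin 3 → E3 → ℂ

/-- `u ∈ (H²₀(Ω))³`. -/
def MemH20Vec (Ω : Set E3) (u : VField) : Prop :=
  ∀ i, MemH20 Ω (u i)

/-- `‖u‖²` in `(H²₀(Ω))³`, the norm inherited from `(H²(Ω))³`. -/
def h2NormSqVec (Ω : Set E3) (u : VField) : ℝ :=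
  ∑ i, h2NormSq Ω (u i)

/-- Divergence `∇ · u`. -/
def divergence (Ω : Set E3) (u : VField) : E3 → ℂ :=
  fun x => ∑ j, weakPartial Ω j (u j) x

/-- The Lamé operator `Δ* u = μ Δ u + (λ + μ) ∇ (∇ · u)`. -/
def lame (lam mu : ℝ) (Ω : Set E3) (u : VField) : VField :=
  fun i x => (mu : ℂ) * ∑ j, weakPartial Ω j (weakPartial Ω j (u i)) x
    + ((lam + mu : ℝ) : ℂ) * weakPartial Ω i (divergence Ω u) x

/-- Kronecker's delta. -/
def kron (i j : Fin 3) : ℝ := if i = j then 1 else 0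

/-- The isotropic elastic moduli
`C_{ijkl} = λ δ_{ij} δ_{kl} + μ (δ_{ik} δ_{jl} + δ_{il} δ_{jk})`. -/
def moduli (lam mu : ℝ) (i j k l : Fin 3) : ℝ :=
  lam * (kron i j * kron k l) + mu * (kron i k * kron j l + kron i l * kron j k)

/-- The sesquilinear form
`a(u,h) = ∫ (1-ρ)⁻¹ (Δ*+ω²)u · conj((Δ*+ω²)h) + ω² ∫ ∇u : C : ∇(conj h) - ω⁴ ∫ u · conj h`. -/
def formA (lam mu : ℝ) (Ω : Set E3) (ρ : E3 → ℝ) (ω : ℝ) (u h : VField) : ℂ :=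
  (∫ x in Ω, (((1 - ρ x)⁻¹ : ℝ) : ℂ) *
      ∑ i, (lame lam mu Ω u i x + (ω : ℂ) ^ 2 * u i x)
        * conj (lame lam mu Ω h i x + (ω : ℂ) ^ 2 * h i x))
    + (ω : ℂ) ^ 2 * (∫ x in Ω, ∑ i, ∑ j, ∑ k, ∑ l,
        weakPartial Ω j (u i) x * (moduli lam mu i j k l : ℂ)
          * conj (weakPartial Ω l (h k) x))
    - (ω : ℂ) ^ 4 * ∫ x in Ω, ∑ i, u i x * conj (h i x)

end ElasticITP

end

/-!
Integrating by parts, `(Δ*u, u) = -D` where `D = ∫ ∇u : C : ∇ū`; writing `X = ‖Δ*u‖²` and `N = ‖u‖²`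
this gives `‖(Δ* + ω²)u‖² = X - 2ω²D + ω⁴N`. If `ess inf ρ > 1` put `σ = -1` and `r = ess sup ρ`; if
`ess sup ρ < 1` put `σ = 1` and `r = ess inf ρ`. In both cases `0 < σ(1 - r)⁻¹ ≤ σ(1 - ρ)⁻¹`, and by
the identity `σ = σ(1 - r)⁻¹ (1 - r)` the number `σ a(u, u)` is at least
`σ(1 - r)⁻¹ (X - (1 + r)ω²D + rω⁴N)`, that is, formally `((-Δ* - ω²)(-Δ* - rω²)u, u)`.

This is coercive when `ω²` and `rω²` lie below the spectrum of `-Δ*`: with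
`K = min(μ, λ + 2μ) λ₁(Ω)` the Poincaré inequality gives `K N ≤ D`, the square `‖(Δ* + K)u‖²` is
non-negative, and together they bound this form from below by a multiple of `X`. Finally `X`
controls the full `H²` norm, because on `H²₀` all integrations by parts are free of boundary terms:
`‖Δ*u‖² = μ²‖∇²u‖² + ((λ + 2μ)² - μ²)‖∇(∇·u)‖²` and `‖∇(∇·u)‖ ≤ ‖∇²u‖`.

The Poincaré inequality with the constant `λ₁(Ω)` needs an eigenfunction. The embedding of `H¹₀(Ω)`
in `L²(Ω)` is compact, for the Fourier transform of `φ` is small in `L²` at high frequencies, and at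
low frequencies it is the pairing of `φ` with a compact family of plane waves. A compact operator
has a top singular vector, and the one of the embedding is a Dirichlet eigenfunction.
-/

noncomputable section

namespace ElasticITP

open Filter Topology

section CompactOperators

variable {𝕜 H E : Type*} [RCLike 𝕜] [NormedAddCommGroup H] [NormedAddCommGroup E]
  [CompleteSpace E]

theorem hasEigenvalue_norm_sq_adjoint_comp_self [CompleteSpace H] [InnerProductSpace 𝕜 H]
    [InnerProductSpace 𝕜 E] {J : H →L[𝕜] E} (hJ : IsCompactOperator J) (hJ0 : J ≠ 0) :
    Module.End.HasEigenvalue ((J.adjoint ∘L J : H →L[𝕜] H) : Module.End 𝕜 H)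
      ((‖J‖ ^ 2 : ℝ) : 𝕜) := by
  have hpos : 0 < ‖J‖ := norm_pos_iff.2 hJ0
  have hnorm : ‖J.adjoint ∘L J‖ = ‖J‖ ^ 2 := by rw [J.norm_adjoint_comp_self, sq]
  have : Nontrivial H := not_subsingleton_iff_nontrivial.1 fun _ => hJ0 (Subsingleton.elim _ _)
  refine (IsCompactOperator.hasEigenvalue_or_mem_resolventSet (hJ.clm_comp J.adjoint)
    (by exact_mod_cast (pow_pos hpos 2).ne')).resolve_right fun hres => ?_
  rw [← hnorm] at hres
  obtain ⟨ε, hε, hle⟩ :=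
    ContinuousLinearMap.rayleighQuotient_le_of_norm_mem_resolventSet _ hres
  have hsq (x : H) : ‖J x‖ ^ 2 ≤ (‖J‖ ^ 2 - ε) * ‖x‖ ^ 2 := by
    rcases eq_or_ne x 0 with rfl | hx
    · simp
    · rw [← div_le_iff₀ (pow_pos (norm_pos_iff.2 hx) 2),
        J.apply_norm_sq_eq_inner_adjoint_left, ← hnorm]
      exact hle x
  have hbound : ‖J‖ ≤ √(‖J‖ ^ 2 - ε) := J.opNorm_le_bound (Real.sqrt_nonneg _) fun x => by
    rw [← Real.sqrt_sq (norm_nonneg x), ← Real.sqrt_mul' _ (sq_nonneg _)]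
    exact Real.le_sqrt_of_sq_le (hsq x)
  exact (Real.sqrt_lt' hpos |>.2 (sub_lt_self _ hε)).not_ge hbound

theorem exists_top_singular_vector [CompleteSpace H] [InnerProductSpace 𝕜 H]
    [InnerProductSpace 𝕜 E] {J : H →L[𝕜] E} (hJ : IsCompactOperator J) (hJ0 : J ≠ 0) :
    ∃ κ : ℝ, 0 < κ ∧ (∀ x, ‖J x‖ ^ 2 ≤ κ * ‖x‖ ^ 2) ∧
      ∃ w, w ≠ 0 ∧ ∀ x, inner 𝕜 (J x) (J w) = (κ : 𝕜) * inner 𝕜 x w := by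
  obtain ⟨w, hw⟩ := (hasEigenvalue_norm_sq_adjoint_comp_self hJ hJ0).exists_hasEigenvector
  refine ⟨‖J‖ ^ 2, pow_pos (norm_pos_iff.2 hJ0) 2, fun x => ?_, w, hw.2, fun x => ?_⟩
  · rw [← mul_pow]
    exact pow_le_pow_left₀ (norm_nonneg _) (J.le_opNorm x) 2
  · rw [← J.adjoint_inner_right, ← inner_smul_right]
    exact congrArg _ hw.apply_eq_smul

theorem isCompactOperator_of_forall_norm_sq_le [NormedSpace 𝕜 H]
    [InnerProductSpace 𝕜 E] {J : H →L[𝕜] E}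
    (h : ∀ ε : ℝ, 0 < ε → ∃ (s : Finset E) (C : ℝ), ∀ x,
      ‖J x‖ ^ 2 ≤ ε * ‖x‖ ^ 2 + C * ∑ g ∈ s, ‖inner 𝕜 g (J x)‖ ^ 2) :
    IsCompactOperator J := by
  refine (isCompactOperator_iff_isCompact_closure_image_closedBall (J : H →ₗ[𝕜] E)
    one_pos).2 ((Metric.totallyBounded_iff.2 fun r hr => ?_).closure
      |>.isCompact_of_isClosed isClosed_closure)
  obtain ⟨s, C, hsC⟩ := h (r ^ 2 / 8) (by positivity)
  let A : H →L[𝕜] (s → 𝕜) := ContinuousLinearMap.pi fun g => innerSL 𝕜 (g : E) ∘L J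
  have hsmall : ∀ᶠ z : s → 𝕜 in 𝓝 0, C * ∑ l, ‖z l‖ ^ 2 < r ^ 2 / 2 :=
    ContinuousAt.eventually_lt (Continuous.continuousAt (by fun_prop)) continuousAt_const
      (by simpa using by positivity)
  obtain ⟨δ, hδ, hAδ⟩ := Metric.eventually_nhds_iff.1 hsmall
  have htotally : TotallyBounded (A '' Metric.closedBall 0 1) :=
    (A.lipschitz.isBounded_image Metric.isBounded_closedBall).isCompact_closure.totallyBounded
      |>.subset subset_closure
  obtain ⟨t, htB, ht, hcover⟩ := Set.exists_subset_image_finite_and.1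
    (Metric.finite_approx_of_totallyBounded htotally δ hδ)
  refine ⟨J '' t, ht.image J, ?_⟩
  rintro _ ⟨x, hx, rfl⟩
  obtain ⟨_, ⟨z, hz, rfl⟩, hxz⟩ := Set.mem_iUnion₂.1 (hcover (Set.mem_image_of_mem A hx))
  have hnorm : ‖x - z‖ ≤ 2 := (norm_sub_le _ _).trans (by
    linarith [mem_closedBall_zero_iff.1 hx, mem_closedBall_zero_iff.1 (htB hz)])
  have hsum : C * ∑ g ∈ s, ‖inner 𝕜 g (J (x - z))‖ ^ 2 < r ^ 2 / 2 := by
    rw [← Finset.sum_coe_sort s fun g => ‖inner 𝕜 g (J (x - z))‖ ^ 2]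
    exact hAδ (y := A (x - z)) (by rwa [map_sub, dist_zero_right, ← dist_eq_norm])
  refine Set.mem_iUnion₂.2 ⟨J z, Set.mem_image_of_mem J hz, ?_⟩
  rw [Metric.mem_ball, dist_eq_norm, ContinuousLinearMap.coe_coe, ← map_sub]
  refine lt_of_pow_lt_pow_left₀ 2 hr.le ((hsC _).trans_lt ?_)
  nlinarith [norm_nonneg (x - z), mul_pos hr hr, pow_le_pow_left₀ (norm_nonneg _) hnorm 2]

theorem exists_top_singular_vector_of_mem [InnerProductSpace 𝕜 H] [InnerProductSpace 𝕜 E]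
    {V : Submodule 𝕜 H} [CompleteSpace V] {J : H →L[𝕜] E}
    (hJ : ∀ ε : ℝ, 0 < ε → ∃ (s : Finset E) (C : ℝ), ∀ x ∈ V,
      ‖J x‖ ^ 2 ≤ ε * ‖x‖ ^ 2 + C * ∑ g ∈ s, ‖inner 𝕜 g (J x)‖ ^ 2)
    {z : H} (hz : z ∈ V) (hJz : J z ≠ 0) :
    ∃ κ : ℝ, 0 < κ ∧ (∀ x ∈ V, ‖J x‖ ^ 2 ≤ κ * ‖x‖ ^ 2) ∧
      ∃ w ∈ V, w ≠ 0 ∧ ∀ x ∈ V, inner 𝕜 (J x) (J w) = (κ : 𝕜) * inner 𝕜 x w := by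
  have hcompact : IsCompactOperator (J ∘L V.subtypeL) :=
    isCompactOperator_of_forall_norm_sq_le (𝕜 := 𝕜) fun ε hε =>
      let ⟨s, C, hsC⟩ := hJ ε hε
      ⟨s, C, fun x => hsC x x.2⟩
  obtain ⟨κ, hκ, hmax, w, hw0, hw⟩ := exists_top_singular_vector hcompact
    fun h => hJz (DFunLike.congr_fun h ⟨z, hz⟩)
  exact ⟨κ, hκ, fun x hx => hmax ⟨x, hx⟩, w, w.2, fun h => hw0 (Subtype.ext h),
    fun x hx => hw ⟨x, hx⟩⟩

end CompactOperators

section LameAlgebra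

theorem min_mul_le_mul_sub_add_mul {p q S Z : ℝ} (hZ : 0 ≤ Z) (hZS : Z ≤ S) :
    min p q * S ≤ p * (S - Z) + q * Z := by
  nlinarith [mul_le_mul_of_nonneg_right (min_le_left p q) (sub_nonneg.2 hZS),
    mul_le_mul_of_nonneg_right (min_le_right p q) hZ]

/-- The spectral estimate `(κ - a) (κ - b) ≥ (1 - a / K) (1 - b / K) κ ^ 2` for `κ ≥ K`, with the
moments `N`, `D`, `X` of a spectral measure in place of the powers `1`, `κ`, `κ ^ 2`. -/
theorem quadratic_lower_bound {a b K X D N : ℝ} (hK : 0 < K) (ha : 0 ≤ a) (haK : a ≤ K)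
    (hb : 0 ≤ b) (hbK : b ≤ K) (hD : K * N ≤ D) (hX : 0 ≤ X - 2 * K * D + K ^ 2 * N) :
    (1 - a / K) * (1 - b / K) * X ≤ X - (a + b) * D + a * b * N := by
  obtain ⟨s, rfl⟩ : ∃ s, a = s * K := ⟨a / K, by field_simp⟩
  obtain ⟨t, rfl⟩ : ∃ t, b = t * K := ⟨b / K, by field_simp⟩
  have hs : 0 ≤ s := nonneg_of_mul_nonneg_left ha hK
  have ht : 0 ≤ t := nonneg_of_mul_nonneg_left hb hK
  have hs1 : 0 ≤ 1 - s := by nlinarith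
  have ht1 : 0 ≤ 1 - t := by nlinarith
  rw [mul_div_cancel_right₀ _ hK.ne', mul_div_cancel_right₀ _ hK.ne', ← sub_nonneg]
  calc 0 ≤ (s * (1 - t) + t) * (X - 2 * K * D + K ^ 2 * N)
        + (s * (1 - t) + t * (1 - s)) * K * (D - K * N) := by
        have := sub_nonneg.2 hD
        positivity
    _ = _ := by ring

variable {𝕜 ι E : Type*} [RCLike 𝕜] [Fintype ι] [NormedAddCommGroup E] [InnerProductSpace 𝕜 E]

theorem norm_sum_sq_eq_re_sum_inner (x : ι → E) :
    ‖∑ i, x i‖ ^ 2 = ∑ i, ∑ j, RCLike.re (inner 𝕜 (x i) (x j)) := by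
  rw [← inner_self_eq_norm_sq (𝕜 := 𝕜), sum_inner, map_sum]
  simp only [inner_sum, map_sum]

theorem norm_sum_diag_sq_le {x : ι → ι → E}
    (hx : ∀ a b i j, inner 𝕜 (x a i) (x b j) = inner 𝕜 (x a j) (x b i)) :
    ‖∑ i, x i i‖ ^ 2 ≤ ∑ i, ∑ j, ‖x i j‖ ^ 2 := by
  have hsymm : ∑ i, ∑ j, ‖x j i‖ ^ 2 = ∑ i, ∑ j, ‖x i j‖ ^ 2 := Finset.sum_comm
  have hpair (i j : ι) :
      2 * RCLike.re (inner 𝕜 (x i i) (x j j)) ≤ ‖x i j‖ ^ 2 + ‖x j i‖ ^ 2 := by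
    rw [hx i j i j]
    nlinarith [re_inner_le_norm (𝕜 := 𝕜) (x i j) (x j i), sq_nonneg (‖x i j‖ - ‖x j i‖)]
  have hsum := Finset.sum_le_sum fun i (_ : i ∈ Finset.univ) =>
    Finset.sum_le_sum fun j (_ : j ∈ Finset.univ) => hpair i j
  simp only [Finset.sum_add_distrib, ← Finset.mul_sum, hsymm,
    ← norm_sum_sq_eq_re_sum_inner (𝕜 := 𝕜)] at hsum
  linarith

theorem norm_sum_diag_sq_eq {x : ι → ι → E} (hsymm : ∀ i j, x i j = x j i)
    (hx : ∀ i j k l, inner 𝕜 (x i j) (x k l) = inner 𝕜 (x k j) (x i l)) :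
    ‖∑ i, x i i‖ ^ 2 = ∑ i, ∑ j, ‖x i j‖ ^ 2 := by
  rw [norm_sum_sq_eq_re_sum_inner (𝕜 := 𝕜)]
  refine Finset.sum_congr rfl fun i _ => Finset.sum_congr rfl fun j _ => ?_
  rw [hx i i j j, hsymm j i, inner_self_eq_norm_sq]

/-- `f a`, `x a i` and `y a i j` play the roles of `u_a`, `∂_i u_a` and `∂_i ∂_j u_a`. -/
theorem sum_inner_lame {f : ι → E} {x : ι → ι → E} {y : ι → ι → ι → E}
    (h : ∀ a b i j, inner 𝕜 (f b) (y a i j) = -inner 𝕜 (x b i) (x a j)) (p q : ℝ) :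
    ∑ a, inner 𝕜 (f a) ((p : 𝕜) • ∑ j, y a j j + (q : 𝕜) • ∑ j, y j a j)
      = -((p * ∑ a, ∑ i, ‖x a i‖ ^ 2 + q * ‖∑ i, x i i‖ ^ 2 : ℝ) : 𝕜) := by
  have hdiv : ∑ a, ∑ j, inner 𝕜 (x a a) (x j j) = ((‖∑ i, x i i‖ ^ 2 : ℝ) : 𝕜) := by
    rw [RCLike.ofReal_pow, ← inner_self_eq_norm_sq_to_K, sum_inner]
    simp only [inner_sum]
  simp only [inner_add_right, inner_smul_right, inner_sum, h, Finset.sum_neg_distrib,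
    Finset.sum_add_distrib, ← Finset.mul_sum, hdiv, inner_self_eq_norm_sq_to_K]
  push_cast
  ring

theorem norm_real_smul_add_real_smul_sq (p q : ℝ) (v w : E) :
    ‖(p : 𝕜) • v + (q : 𝕜) • w‖ ^ 2
      = p ^ 2 * ‖v‖ ^ 2 + 2 * p * q * RCLike.re (inner 𝕜 v w) + q ^ 2 * ‖w‖ ^ 2 := by
  rw [norm_add_sq (𝕜 := 𝕜), inner_smul_left, inner_smul_right, RCLike.conj_ofReal,
    RCLike.re_ofReal_mul, RCLike.re_ofReal_mul, norm_smul, norm_smul, mul_pow, mul_pow,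
    RCLike.norm_ofReal, RCLike.norm_ofReal, sq_abs, sq_abs]
  ring

theorem sum_norm_lame_sq {y : ι → ι → ι → E} (hsymm : ∀ a i j, y a i j = y a j i)
    (hy : ∀ a b i j k l, inner 𝕜 (y a i j) (y b k l) = inner 𝕜 (y a k j) (y b i l)) (p q : ℝ) :
    ∑ a, ‖(p : 𝕜) • ∑ j, y a j j + (q : 𝕜) • ∑ j, y j a j‖ ^ 2
      = p ^ 2 * ∑ a, ∑ i, ∑ j, ‖y a i j‖ ^ 2
        + ((p + q) ^ 2 - p ^ 2) * ∑ a, ‖∑ j, y j a j‖ ^ 2 := by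
  have hcross : ∑ a, RCLike.re (inner 𝕜 (∑ j, y a j j) (∑ j, y j a j))
      = ∑ a, ‖∑ j, y j a j‖ ^ 2 := by
    calc _ = ∑ a, ∑ k, ∑ j, RCLike.re (inner 𝕜 (y a k k) (y j a j)) := by
          simp only [sum_inner, inner_sum, map_sum]
          exact Finset.sum_congr rfl fun _ _ => Finset.sum_comm
      _ = ∑ a, ∑ k, ∑ j, RCLike.re (inner 𝕜 (y a k a) (y j k j)) := by
          refine Finset.sum_congr rfl fun a _ => Finset.sum_congr rfl fun k _ =>
            Finset.sum_congr rfl fun j _ => ?_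
          rw [hy, hsymm a a k]
      _ = _ := by
          rw [Finset.sum_comm]
          simp only [norm_sum_sq_eq_re_sum_inner (𝕜 := 𝕜)]
  simp only [norm_real_smul_add_real_smul_sq, Finset.sum_add_distrib, ← Finset.mul_sum, hcross,
    fun a => norm_sum_diag_sq_eq (hsymm a) (hy a a)]
  ring

theorem min_sq_mul_sum_norm_sq_le_sum_norm_lame_sq {y : ι → ι → ι → E}
    (hsymm : ∀ a i j, y a i j = y a j i)
    (hy : ∀ a b i j k l, inner 𝕜 (y a i j) (y b k l) = inner 𝕜 (y a k j) (y b i l)) {p q : ℝ}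
    (hp : 0 < p) (hpq : 0 < p + q) :
    min p (p + q) ^ 2 * ∑ a, ∑ i, ∑ j, ‖y a i j‖ ^ 2
      ≤ ∑ a, ‖(p : 𝕜) • ∑ j, y a j j + (q : 𝕜) • ∑ j, y j a j‖ ^ 2 := by
  have hdiv : ∑ a, ‖∑ j, y j a j‖ ^ 2 ≤ ∑ a, ∑ i, ∑ j, ‖y a i j‖ ^ 2 := by
    calc ∑ a, ‖∑ j, y j a j‖ ^ 2 ≤ ∑ a, ∑ j, ∑ k, ‖y j a k‖ ^ 2 := by
          refine Finset.sum_le_sum fun a _ => ?_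
          simp only [fun j => hsymm j a]
          exact norm_sum_diag_sq_le fun j l i k => hy j l i a k a
      _ = _ := Finset.sum_comm
  have hmin : min p (p + q) ^ 2 ≤ min (p ^ 2) ((p + q) ^ 2) :=
    le_min (pow_le_pow_left₀ (by positivity) (min_le_left _ _) 2)
      (pow_le_pow_left₀ (by positivity) (min_le_right _ _) 2)
  calc _ ≤ min (p ^ 2) ((p + q) ^ 2) * ∑ a, ∑ i, ∑ j, ‖y a i j‖ ^ 2 := by gcongr
    _ ≤ _ := min_mul_le_mul_sub_add_mul (by positivity) hdiv
    _ = _ := by rw [sum_norm_lame_sq hsymm hy]; ring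

end LameAlgebra

section TestFunctions

variable {Ω : Set E3} {φ ψ f : E3 → ℂ}

theorem tsupport_classicalPartial_subset (i : Fin 3) (φ : E3 → ℂ) :
    tsupport (classicalPartial i φ) ⊆ tsupport φ :=
  tsupport_fderiv_apply_subset ℝ (EuclideanSpace.single i (1 : ℝ))

theorem IsTestFunction.partial (h : IsTestFunction Ω φ) (i : Fin 3) :
    IsTestFunction Ω (classicalPartial i φ) :=
  ⟨(h.1.fderiv_right (m := (⊤ : ℕ∞)) le_rfl).clm_apply contDiff_const,
    h.2.1.mono' ((subset_tsupport _).trans (tsupport_classicalPartial_subset i φ)),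
    (tsupport_classicalPartial_subset i φ).trans h.2.2⟩

theorem IsTestFunction.differentiable (h : IsTestFunction Ω φ) : Differentiable ℝ φ :=
  h.1.differentiable (by simp)

theorem IsTestFunction.continuous (h : IsTestFunction Ω φ) : Continuous φ := h.1.continuous

theorem IsTestFunction.eq_zero_of_notMem (h : IsTestFunction Ω φ) {x : E3} (hx : x ∉ Ω) :
    φ x = 0 :=
  image_eq_zero_of_notMem_tsupport fun hx' => hx (h.2.2 hx')

theorem isTestFunction_zero : IsTestFunction Ω (0 : E3 → ℂ) :=
  ⟨contDiff_const, HasCompactSupport.zero, by simp [tsupport]⟩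

theorem IsTestFunction.add (hφ : IsTestFunction Ω φ) (hψ : IsTestFunction Ω ψ) :
    IsTestFunction Ω (φ + ψ) :=
  ⟨hφ.1.add hψ.1, hφ.2.1.add hψ.2.1,
    (tsupport_add φ ψ).trans (Set.union_subset hφ.2.2 hψ.2.2)⟩

theorem IsTestFunction.const_smul (c : ℂ) (hφ : IsTestFunction Ω φ) :
    IsTestFunction Ω (c • φ) :=
  ⟨contDiff_const.smul hφ.1, hφ.2.1.smul_left (f := fun _ => c),
    (tsupport_smul_subset_right (fun _ => c) φ).trans hφ.2.2⟩

theorem IsTestFunction.conj (hφ : IsTestFunction Ω φ) :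
    IsTestFunction Ω (fun x => conj (φ x)) := by
  have hs : tsupport (fun x => conj (φ x)) ⊆ tsupport φ := tsupport_comp_subset (map_zero _) φ
  exact ⟨Complex.conjCLE.contDiff.comp hφ.1, hφ.2.1.mono' ((subset_tsupport _).trans hs),
    hs.trans hφ.2.2⟩

theorem isTestFunction_ofReal {η : E3 → ℝ} (hη : ContDiff ℝ (⊤ : ℕ∞) η)
    (hηc : HasCompactSupport η) (hηΩ : tsupport η ⊆ Ω) : IsTestFunction Ω fun x => (η x : ℂ) := by
  have hs : tsupport (fun x => (η x : ℂ)) ⊆ tsupport η :=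
    tsupport_comp_subset Complex.ofReal_zero η
  exact ⟨Complex.ofRealCLM.contDiff.comp hη, hηc.mono' ((subset_tsupport _).trans hs),
    hs.trans hηΩ⟩

theorem classicalPartial_add (hφ : Differentiable ℝ φ) (hψ : Differentiable ℝ ψ) (i : Fin 3) :
    classicalPartial i (φ + ψ) = classicalPartial i φ + classicalPartial i ψ := by
  ext x
  simp only [classicalPartial, Pi.add_apply, fderiv_add (hφ x) (hψ x), add_apply]

theorem classicalPartial_const_smul (c : ℂ) (hφ : Differentiable ℝ φ) (i : Fin 3) :
    classicalPartial i (c • φ) = c • classicalPartial i φ := by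
  ext x
  simp only [classicalPartial, Pi.smul_apply, fderiv_const_smul (hφ x), smul_apply]

theorem classicalPartial_conj (hφ : Differentiable ℝ φ) (i : Fin 3) (x : E3) :
    classicalPartial i (fun y => conj (φ y)) x = conj (classicalPartial i φ x) := by
  have h : HasFDerivAt (fun y => conj (φ y))
      (Complex.conjCLE.toContinuousLinearMap.comp (fderiv ℝ φ x)) x :=
    Complex.conjCLE.toContinuousLinearMap.hasFDerivAt.comp x (hφ x).hasFDerivAt
  simp [classicalPartial, h.fderiv]

theorem classicalPartial_comm (hφ : ContDiff ℝ 2 φ) (i j : Fin 3) :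
    classicalPartial i (classicalPartial j φ) = classicalPartial j (classicalPartial i φ) := by
  ext x
  have hd : Differentiable ℝ (fderiv ℝ φ) :=
    (hφ.fderiv_right (m := 1) (by norm_num)).differentiable (by simp)
  have hiter : ∀ a b : Fin 3, classicalPartial a (classicalPartial b φ) x
      = fderiv ℝ (fderiv ℝ φ) x (EuclideanSpace.single a 1) (EuclideanSpace.single b 1) := by
    intro a b
    have : HasFDerivAt (fun y => fderiv ℝ φ y (EuclideanSpace.single b 1))
        ((fderiv ℝ (fderiv ℝ φ) x).flip (EuclideanSpace.single b 1)) x := by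
      simpa using (hd x).hasFDerivAt.clm_apply
        (hasFDerivAt_const (EuclideanSpace.single b (1 : ℝ) : E3) x)
    unfold classicalPartial
    rw [this.fderiv, ContinuousLinearMap.flip_apply]
  rw [hiter, hiter]
  exact hφ.contDiffAt.isSymmSndFDerivAt (by simp) _ _

theorem IsTestFunction.classicalPartial_comm (h : IsTestFunction Ω φ) (i j : Fin 3) :
    classicalPartial i (classicalPartial j φ) = classicalPartial j (classicalPartial i φ) :=
  ElasticITP.classicalPartial_comm (h.1.of_le (WithTop.coe_le_coe.2 le_top)) i j

theorem IsTestFunction.memL2 (h : IsTestFunction Ω φ) : MemL2 Ω φ :=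
  (h.continuous.memLp_of_hasCompactSupport h.2.1).restrict Ω

theorem IsTestFunction.integrableOn_mul (h : IsTestFunction Ω φ)
    (hf : LocallyIntegrableOn f Ω volume) : IntegrableOn (fun x => f x * φ x) Ω volume := by
  have hK : IntegrableOn (fun x => f x * φ x) (tsupport φ) volume :=
    (hf.integrableOn_compact_subset h.2.2 h.2.1).mul_continuousOn h.continuous.continuousOn h.2.1
  refine ((integrableOn_iff_integrable_of_support_subset fun x hx => ?_).1 hK).integrableOn
  exact subset_tsupport φ (right_ne_zero_of_mul hx)

theorem integral_mul_classicalPartial (hφ : IsTestFunction Ω φ) (hψ : IsTestFunction Ω ψ)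
    (i : Fin 3) :
    ∫ x in Ω, φ x * classicalPartial i ψ x = -∫ x in Ω, classicalPartial i φ x * ψ x := by
  have setIntegral_eq : ∀ {f g : E3 → ℂ}, IsTestFunction Ω g →
      ∫ x in Ω, f x * g x = ∫ x, f x * g x := fun hg =>
    setIntegral_eq_integral_of_forall_compl_eq_zero fun x hx => by
      rw [hg.eq_zero_of_notMem hx, mul_zero]
  have integrable_mul : ∀ {f g : E3 → ℂ}, IsTestFunction Ω f → IsTestFunction Ω g →
      Integrable (fun x => f x * g x) volume := fun hf hg =>
    (hf.continuous.mul hg.continuous).integrable_of_hasCompactSupport hg.2.1.mul_left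
  rw [setIntegral_eq (hψ.partial i), setIntegral_eq hψ]
  exact integral_mul_fderiv_eq_neg_fderiv_mul_of_integrable (integrable_mul (hφ.partial i) hψ)
    (integrable_mul hφ (hψ.partial i)) (integrable_mul hφ hψ) (fun x _ => hφ.differentiable x)
    (fun x _ => hψ.differentiable x)

end TestFunctions

section L2Class

/-- The Hilbert space `L²(Ω)` of classes of functions. -/
abbrev L2Space (Ω : Set E3) : Type := Lp ℂ 2 (volume.restrict Ω)

open Classical in
/-- The class of `u` in `L²(Ω)`, and `0` if `u` is not square integrable. -/
def l2Class (Ω : Set E3) (u : E3 → ℂ) : L2Space Ω :=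
  if h : MemLp u 2 (volume.restrict Ω) then h.toLp u else 0

variable {Ω : Set E3} {u v : E3 → ℂ}

theorem MemL2.l2Class_ae_eq (h : MemL2 Ω u) : l2Class Ω u =ᵐ[volume.restrict Ω] u := by
  rw [MemL2] at h
  rw [l2Class, dif_pos h]
  exact h.coeFn_toLp

theorem memL2_coe (f : L2Space Ω) : MemL2 Ω f := Lp.memLp f

theorem l2Class_coe (f : L2Space Ω) : l2Class Ω f = f :=
  Lp.ext (memL2_coe f).l2Class_ae_eq

theorem l2Class_congr (h : u =ᵐ[volume.restrict Ω] v) : l2Class Ω u = l2Class Ω v := by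
  by_cases hu : MemLp u 2 (volume.restrict Ω)
  · have hv : MemL2 Ω v := hu.ae_eq h
    exact Lp.ext ((MemL2.l2Class_ae_eq hu).trans (h.trans hv.l2Class_ae_eq.symm))
  · rw [l2Class, l2Class, dif_neg hu, dif_neg (mt (memLp_congr_ae h).2 hu)]

theorem MemL2.add (hu : MemL2 Ω u) (hv : MemL2 Ω v) : MemL2 Ω (u + v) := MemLp.add hu hv

theorem MemL2.sub (hu : MemL2 Ω u) (hv : MemL2 Ω v) : MemL2 Ω (u - v) := MemLp.sub hu hv

theorem MemL2.const_smul (c : ℂ) (hu : MemL2 Ω u) : MemL2 Ω (c • u) := MemLp.const_smul hu c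

theorem MemL2.locallyIntegrableOn (hu : MemL2 Ω u) : LocallyIntegrableOn u Ω volume :=
  locallyIntegrableOn_of_locallyIntegrable_restrict
    (MemLp.locallyIntegrable hu (by norm_num))

theorem l2Class_add (hu : MemL2 Ω u) (hv : MemL2 Ω v) :
    l2Class Ω (u + v) = l2Class Ω u + l2Class Ω v :=
  Lp.ext ((hu.add hv).l2Class_ae_eq.trans ((hu.l2Class_ae_eq.add hv.l2Class_ae_eq).symm.trans
    (Lp.coeFn_add _ _).symm))

theorem l2Class_sub (hu : MemL2 Ω u) (hv : MemL2 Ω v) :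
    l2Class Ω (u - v) = l2Class Ω u - l2Class Ω v :=
  Lp.ext ((hu.sub hv).l2Class_ae_eq.trans ((hu.l2Class_ae_eq.sub hv.l2Class_ae_eq).symm.trans
    (Lp.coeFn_sub _ _).symm))

theorem l2Class_const_smul (c : ℂ) (hu : MemL2 Ω u) : l2Class Ω (c • u) = c • l2Class Ω u :=
  Lp.ext ((hu.const_smul c).l2Class_ae_eq.trans ((hu.l2Class_ae_eq.const_smul c).symm.trans
    (Lp.coeFn_smul _ _).symm))

theorem inner_l2Class (hu : MemL2 Ω u) (hv : MemL2 Ω v) :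
    inner ℂ (l2Class Ω u) (l2Class Ω v) = ∫ x in Ω, v x * conj (u x) := by
  rw [L2.inner_def]
  refine integral_congr_ae ?_
  filter_upwards [hu.l2Class_ae_eq, hv.l2Class_ae_eq] with x hux hvx
  rw [hux, hvx, RCLike.inner_apply]

theorem integrable_mul_conj (hu : MemL2 Ω u) (hv : MemL2 Ω v) :
    Integrable (fun x => v x * conj (u x)) (volume.restrict Ω) := by
  refine (L2.integrable_inner (𝕜 := ℂ) (l2Class Ω u) (l2Class Ω v)).congr ?_
  filter_upwards [hu.l2Class_ae_eq, hv.l2Class_ae_eq] with x hux hvx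
  rw [hux, hvx, RCLike.inner_apply]

theorem norm_sq_l2Class (hu : MemL2 Ω u) : ‖l2Class Ω u‖ ^ 2 = l2NormSq Ω u := by
  rw [@norm_sq_eq_re_inner ℂ, inner_l2Class hu hu, l2NormSq]
  simp only [Complex.mul_conj, Complex.normSq_eq_norm_sq]
  rw [integral_complex_ofReal]
  exact Complex.ofReal_re _

end L2Class

section WeakDerivative

variable {Ω : Set E3} {u v g k : E3 → ℂ} {i j : Fin 3}

theorem HasWeakPartial.congr (h : HasWeakPartial Ω i u g) (huv : u =ᵐ[volume.restrict Ω] v)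
    (hgk : g =ᵐ[volume.restrict Ω] k) : HasWeakPartial Ω i v k := by
  refine ⟨h.1.congr huv, h.2.1.congr hgk, fun φ hφ => ?_⟩
  have hu := integral_congr_ae (huv.mul (.refl _ (classicalPartial i φ)))
  have hg := integral_congr_ae (hgk.mul (.refl _ φ))
  simp only [Pi.mul_apply] at hu hg
  rw [← hu, ← hg, h.2.2 φ hφ]

theorem weakPartial_congr (huv : u =ᵐ[volume.restrict Ω] v) :
    weakPartial Ω i u = weakPartial Ω i v := by
  have h : HasWeakPartial Ω i u = HasWeakPartial Ω i v := funext fun g =>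
    propext ⟨fun hg => hg.congr huv (.refl _ g), fun hg => hg.congr huv.symm (.refl _ g)⟩
  unfold weakPartial
  rw [h]

theorem hasWeakPartial_zero : HasWeakPartial Ω i 0 0 :=
  ⟨locallyIntegrableOn_zero, locallyIntegrableOn_zero, fun φ _ => by simp⟩

theorem HasWeakPartial.add (hu : HasWeakPartial Ω i u g) (hv : HasWeakPartial Ω i v k) :
    HasWeakPartial Ω i (u + v) (g + k) := by
  refine ⟨hu.1.add hv.1, hu.2.1.add hv.2.1, fun φ hφ => ?_⟩
  have hφ' := hφ.partial i
  simp only [Pi.add_apply, add_mul]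
  rw [integral_add (hφ'.integrableOn_mul hu.1) (hφ'.integrableOn_mul hv.1),
    integral_add (hφ.integrableOn_mul hu.2.1) (hφ.integrableOn_mul hv.2.1), hu.2.2 φ hφ,
    hv.2.2 φ hφ, neg_add]

theorem HasWeakPartial.neg (hu : HasWeakPartial Ω i u g) : HasWeakPartial Ω i (-u) (-g) := by
  refine ⟨hu.1.neg, hu.2.1.neg, fun φ hφ => ?_⟩
  simp only [Pi.neg_apply, neg_mul, integral_neg, hu.2.2 φ hφ]

theorem HasWeakPartial.sub (hu : HasWeakPartial Ω i u g) (hv : HasWeakPartial Ω i v k) :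
    HasWeakPartial Ω i (u - v) (g - k) := by
  simpa only [sub_eq_add_neg] using hu.add hv.neg

theorem HasWeakPartial.sum {ι : Type*} (s : Finset ι) {u g : ι → E3 → ℂ}
    (h : ∀ a ∈ s, HasWeakPartial Ω i (u a) (g a)) :
    HasWeakPartial Ω i (∑ a ∈ s, u a) (∑ a ∈ s, g a) := by
  classical
  induction s using Finset.induction_on with
  | empty => simpa using hasWeakPartial_zero
  | insert a s ha ih =>
    rw [Finset.sum_insert ha, Finset.sum_insert ha]
    exact (h a (Finset.mem_insert_self a s)).add
      (ih fun b hb => h b (Finset.mem_insert_of_mem hb))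

theorem HasWeakPartial.swap {uᵢ uⱼ w : E3 → ℂ} (hi : HasWeakPartial Ω i u uᵢ)
    (hj : HasWeakPartial Ω j u uⱼ) (hij : HasWeakPartial Ω i uⱼ w) : HasWeakPartial Ω j uᵢ w := by
  refine ⟨hi.2.1, hij.2.1, fun φ hφ => ?_⟩
  rw [← hij.2.2 φ hφ, ← neg_eq_iff_eq_neg.2 (hj.2.2 _ (hφ.partial i)), hφ.classicalPartial_comm,
    hi.2.2 _ (hφ.partial j), neg_neg]

theorem HasWeakPartial.unique (ho : IsOpen Ω) (hg : HasWeakPartial Ω i u g)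
    (hk : HasWeakPartial Ω i u k) : g =ᵐ[volume.restrict Ω] k := by
  have hgk : HasWeakPartial Ω i 0 (g - k) := by simpa using hg.sub hk
  have hzero : ∀ᵐ x, x ∈ Ω → (g - k) x = 0 := by
    refine ho.ae_eq_zero_of_integral_contDiff_smul_eq_zero hgk.2.1 fun η hη hηc hηΩ => ?_
    have h := hgk.2.2 _ (isTestFunction_ofReal hη hηc hηΩ)
    rw [← setIntegral_eq_integral_of_forall_compl_eq_zero (s := Ω) fun x hx => by
      rw [image_eq_zero_of_notMem_tsupport fun hx' => hx (hηΩ hx'), zero_smul]]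
    simpa [mul_comm] using h
  filter_upwards [(ae_restrict_iff' ho.measurableSet).2 hzero] with x hx
  exact sub_eq_zero.1 hx

theorem HasWeakPartial.weakPartial (h : HasWeakPartial Ω i u g) :
    HasWeakPartial Ω i u (weakPartial Ω i u) := by
  have hex : ∃ g, HasWeakPartial Ω i u g := ⟨g, h⟩
  rw [ElasticITP.weakPartial, dif_pos hex]
  exact hex.choose_spec

theorem HasWeakPartial.weakPartial_ae_eq (ho : IsOpen Ω) (h : HasWeakPartial Ω i u g) :
    ElasticITP.weakPartial Ω i u =ᵐ[volume.restrict Ω] g :=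
  h.weakPartial.unique ho h

theorem IsTestFunction.hasWeakPartial {φ : E3 → ℂ} (hφ : IsTestFunction Ω φ) (i : Fin 3) :
    HasWeakPartial Ω i φ (classicalPartial i φ) :=
  ⟨hφ.memL2.locallyIntegrableOn, (hφ.partial i).memL2.locallyIntegrableOn,
    fun _ hψ => integral_mul_classicalPartial hφ hψ i⟩

theorem hasWeakPartial_iff_inner (hu : MemL2 Ω u) (hg : MemL2 Ω g) :
    HasWeakPartial Ω i u g ↔ ∀ φ, IsTestFunction Ω φ →
      inner ℂ (l2Class Ω (classicalPartial i φ)) (l2Class Ω u)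
        = -inner ℂ (l2Class Ω φ) (l2Class Ω g) := by
  constructor
  · rintro ⟨-, -, h⟩ φ hφ
    simp only [inner_l2Class (hφ.partial i).memL2 hu, inner_l2Class hφ.memL2 hg,
      ← h _ hφ.conj, classicalPartial_conj hφ.differentiable]
  · refine fun h => ⟨hu.locallyIntegrableOn, hg.locallyIntegrableOn, fun φ hφ => ?_⟩
    have hφ' := h _ hφ.conj
    rw [inner_l2Class (hφ.conj.partial i).memL2 hu, inner_l2Class hφ.conj.memL2 hg] at hφ'
    simpa only [classicalPartial_conj hφ.differentiable, Complex.conj_conj] using hφ'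

theorem MemH1.hasWeakPartial (h : MemH1 Ω u) (i : Fin 3) :
    HasWeakPartial Ω i u (weakPartial Ω i u) :=
  (h.2 i).choose_spec.2.weakPartial

theorem MemH1.memL2_weakPartial (ho : IsOpen Ω) (h : MemH1 Ω u) (i : Fin 3) :
    MemL2 Ω (weakPartial Ω i u) :=
  let ⟨_, hgL, hg⟩ := h.2 i
  MemLp.ae_eq (hg.weakPartial_ae_eq ho).symm hgL

theorem IsTestFunction.memH1 {φ : E3 → ℂ} (hφ : IsTestFunction Ω φ) : MemH1 Ω φ :=
  ⟨hφ.memL2, fun i => ⟨_, (hφ.partial i).memL2, hφ.hasWeakPartial i⟩⟩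

theorem IsTestFunction.weakPartial_ae_eq (ho : IsOpen Ω) {φ : E3 → ℂ} (hφ : IsTestFunction Ω φ)
    (i : Fin 3) : weakPartial Ω i φ =ᵐ[volume.restrict Ω] classicalPartial i φ :=
  (hφ.hasWeakPartial i).weakPartial_ae_eq ho

theorem MemH1.sub (ho : IsOpen Ω) (hu : MemH1 Ω u) (hv : MemH1 Ω v) : MemH1 Ω (u - v) :=
  ⟨hu.1.sub hv.1, fun i => ⟨_, (hu.memL2_weakPartial ho i).sub (hv.memL2_weakPartial ho i),
    (hu.hasWeakPartial i).sub (hv.hasWeakPartial i)⟩⟩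

theorem MemH1.weakPartial_sub_ae_eq (ho : IsOpen Ω) (hu : MemH1 Ω u) (hv : MemH1 Ω v)
    (i : Fin 3) :
    weakPartial Ω i (u - v) =ᵐ[volume.restrict Ω] weakPartial Ω i u - weakPartial Ω i v :=
  ((hu.hasWeakPartial i).sub (hv.hasWeakPartial i)).weakPartial_ae_eq ho

theorem MemH2.weakPartial_comm_ae_eq (ho : IsOpen Ω) (hu : MemH2 Ω u) (i j : Fin 3) :
    weakPartial Ω i (weakPartial Ω j u)
      =ᵐ[volume.restrict Ω] weakPartial Ω j (weakPartial Ω i u) :=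
  (((hu.1.hasWeakPartial j).swap (hu.1.hasWeakPartial i)
    ((hu.2 i).hasWeakPartial j))).weakPartial_ae_eq ho

end WeakDerivative

section Jets

/-- The Hilbert space `L²(Ω) × L²(Ω)³`, which contains `H¹(Ω)` isometrically through
`u ↦ (u, ∇u)`. -/
abbrev JetSpace (Ω : Set E3) : Type :=
  WithLp 2 (L2Space Ω × PiLp 2 fun _ : Fin 3 => L2Space Ω)

/-- The pair of the class of `u` and the class of the vector field `g`, a candidate for `∇u`. -/
def jet (Ω : Set E3) (u : E3 → ℂ) (g : VField) : JetSpace Ω :=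
  WithLp.toLp 2 (l2Class Ω u, WithLp.toLp 2 fun i => l2Class Ω (g i))

/-- The jet `(u, ∇u)` of a function of class `H¹(Ω)`. -/
def weakJet (Ω : Set E3) (u : E3 → ℂ) : JetSpace Ω :=
  jet Ω u fun i => weakPartial Ω i u

/-- The jets `(φ, ∇φ)` of the test functions. -/
def testJets (Ω : Set E3) : Submodule ℂ (JetSpace Ω) where
  carrier := {f | ∃ φ, IsTestFunction Ω φ ∧ jet Ω φ (fun i => classicalPartial i φ) = f}
  zero_mem' := by
    refine ⟨0, isTestFunction_zero, ?_⟩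
    have hpartial : ∀ i, classicalPartial i 0 = 0 := fun i => by
      ext x; simp [classicalPartial]
    have hzero : l2Class Ω 0 = 0 := by simp [l2Class]
    simp only [jet, hpartial, hzero]
    rfl
  add_mem' := by
    rintro _ _ ⟨φ, hφ, rfl⟩ ⟨ψ, hψ, rfl⟩
    refine ⟨φ + ψ, hφ.add hψ, ?_⟩
    simp only [jet, classicalPartial_add hφ.differentiable hψ.differentiable,
      l2Class_add hφ.memL2 hψ.memL2, l2Class_add (hφ.partial _).memL2 (hψ.partial _).memL2]
    rfl
  smul_mem' := by
    rintro c _ ⟨φ, hφ, rfl⟩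
    refine ⟨c • φ, hφ.const_smul c, ?_⟩
    simp only [jet, classicalPartial_const_smul c hφ.differentiable,
      l2Class_const_smul c hφ.memL2, l2Class_const_smul c (hφ.partial _).memL2]
    rfl

/-- The Hilbert space `H¹₀(Ω)`, realised as the closure of the jets of test functions. -/
def h10Space (Ω : Set E3) : Submodule ℂ (JetSpace Ω) :=
  (testJets Ω).topologicalClosure

variable {Ω : Set E3} {u v φ : E3 → ℂ} {g k : VField}

instance : CompleteSpace (h10Space Ω) :=
  (testJets Ω).isClosed_topologicalClosure.completeSpace_coe

theorem jet_congr (huv : u =ᵐ[volume.restrict Ω] v) (hgk : ∀ i, g i =ᵐ[volume.restrict Ω] k i) :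
    jet Ω u g = jet Ω v k := by
  simp only [jet, l2Class_congr huv, fun i => l2Class_congr (hgk i)]

theorem jet_sub (hu : MemL2 Ω u) (hv : MemL2 Ω v) (hg : ∀ i, MemL2 Ω (g i))
    (hk : ∀ i, MemL2 Ω (k i)) :
    jet Ω (u - v) (fun i => g i - k i) = jet Ω u g - jet Ω v k := by
  simp only [jet, l2Class_sub hu hv, fun i => l2Class_sub (hg i) (hk i)]
  rfl

theorem weakJet_sub (ho : IsOpen Ω) (hu : MemH1 Ω u) (hv : MemH1 Ω v) :
    weakJet Ω (u - v) = weakJet Ω u - weakJet Ω v := by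
  rw [weakJet, jet_congr (.refl _ _) (hu.weakPartial_sub_ae_eq ho hv)]
  exact jet_sub hu.1 hv.1 (hu.memL2_weakPartial ho) (hv.memL2_weakPartial ho)

theorem norm_sq_jet (u : E3 → ℂ) (g : VField) :
    ‖jet Ω u g‖ ^ 2 = ‖l2Class Ω u‖ ^ 2 + ∑ i, ‖l2Class Ω (g i)‖ ^ 2 := by
  rw [WithLp.prod_norm_sq_eq_of_L2, PiLp.norm_sq_eq_of_L2]
  rfl

theorem norm_sq_weakJet (ho : IsOpen Ω) (hu : MemH1 Ω u) : ‖weakJet Ω u‖ ^ 2 = h1NormSq Ω u := by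
  simp only [weakJet, norm_sq_jet, h1NormSq, norm_sq_l2Class hu.1,
    norm_sq_l2Class (hu.memL2_weakPartial ho _)]

theorem IsTestFunction.weakJet_eq (ho : IsOpen Ω) (hφ : IsTestFunction Ω φ) :
    weakJet Ω φ = jet Ω φ fun i => classicalPartial i φ :=
  jet_congr (.refl _ _) (hφ.weakPartial_ae_eq ho)

theorem memH10_iff_weakJet_mem (ho : IsOpen Ω) :
    MemH10 Ω u ↔ MemH1 Ω u ∧ weakJet Ω u ∈ h10Space Ω := by
  refine and_congr_right fun hu => ?_
  have dist_sq : ∀ φ, IsTestFunction Ω φ →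
      dist (weakJet Ω u) (weakJet Ω φ) ^ 2 = h1NormSq Ω (u - φ) := fun φ hφ => by
    rw [dist_eq_norm, ← weakJet_sub ho hu hφ.memH1, norm_sq_weakJet ho (hu.sub ho hφ.memH1)]
  change _ ↔ weakJet Ω u ∈ closure (testJets Ω : Set (JetSpace Ω))
  rw [Metric.mem_closure_iff]
  constructor
  · intro h ε hε
    obtain ⟨φ, hφ, hlt⟩ := h (ε ^ 2) (by positivity)
    refine ⟨weakJet Ω φ, ⟨φ, hφ, (hφ.weakJet_eq ho).symm⟩, ?_⟩
    rw [← dist_sq φ hφ] at hlt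
    exact lt_of_pow_lt_pow_left₀ 2 hε.le hlt
  · intro h ε hε
    obtain ⟨_, ⟨φ, hφ, rfl⟩, hlt⟩ := h √ε (Real.sqrt_pos.2 hε)
    refine ⟨φ, hφ, ?_⟩
    rw [← hφ.weakJet_eq ho, Real.lt_sqrt dist_nonneg, dist_sq φ hφ] at hlt
    exact hlt

theorem h10Space_induction {p : JetSpace Ω → Prop} (hclosed : IsClosed {f | p f})
    (htest : ∀ φ, IsTestFunction Ω φ → p (jet Ω φ fun i => classicalPartial i φ))
    {f : JetSpace Ω} (hf : f ∈ h10Space Ω) : p f :=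
  closure_minimal (by rintro _ ⟨φ, hφ, rfl⟩; exact htest φ hφ) hclosed hf

theorem inner_snd_eq_neg_inner_fst (ho : IsOpen Ω) (hv : MemH1 Ω v) (i : Fin 3)
    {f : JetSpace Ω} (hf : f ∈ h10Space Ω) :
    inner ℂ (f.snd i) (l2Class Ω v) = -inner ℂ f.fst (l2Class Ω (weakPartial Ω i v)) := by
  refine h10Space_induction
    (p := fun f => inner ℂ (f.snd i) (l2Class Ω v)
      = -inner ℂ f.fst (l2Class Ω (weakPartial Ω i v)))
    (isClosed_eq (by fun_prop) (by fun_prop)) (fun φ hφ => ?_) hf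
  exact (hasWeakPartial_iff_inner hv.1 (hv.memL2_weakPartial ho i)).1 (hv.hasWeakPartial i) φ hφ

theorem inner_snd_swap (ho : IsOpen Ω) (hv : MemH1 Ω v) (i j : Fin 3) {f : JetSpace Ω}
    (hf : f ∈ h10Space Ω) :
    inner ℂ (f.snd i) (l2Class Ω (weakPartial Ω j v))
      = inner ℂ (f.snd j) (l2Class Ω (weakPartial Ω i v)) := by
  refine h10Space_induction
    (p := fun f => inner ℂ (f.snd i) (l2Class Ω (weakPartial Ω j v))
      = inner ℂ (f.snd j) (l2Class Ω (weakPartial Ω i v)))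
    (isClosed_eq (by fun_prop) (by fun_prop)) (fun φ hφ => ?_) hf
  have green : ∀ k l, inner ℂ (l2Class Ω (classicalPartial k (classicalPartial l φ)))
      (l2Class Ω v)
        = -inner ℂ (l2Class Ω (classicalPartial l φ)) (l2Class Ω (weakPartial Ω k v)) :=
    fun k l => (hasWeakPartial_iff_inner hv.1 (hv.memL2_weakPartial ho k)).1
      (hv.hasWeakPartial k) _ (hφ.partial l)
  have h := green j i
  rw [hφ.classicalPartial_comm, green i j] at h
  exact (neg_injective h).symm

theorem exists_memH10_weakJet_eq (ho : IsOpen Ω) {f : JetSpace Ω} (hf : f ∈ h10Space Ω) :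
    ∃ u, MemH10 Ω u ∧ weakJet Ω u = f := by
  have hpartial : ∀ i, HasWeakPartial Ω i f.fst (f.snd i) := fun i => by
    refine (hasWeakPartial_iff_inner (memL2_coe _) (memL2_coe _)).2 fun φ hφ => ?_
    have h := congrArg conj (inner_snd_eq_neg_inner_fst ho hφ.memH1 i hf)
    rw [map_neg, inner_conj_symm, inner_conj_symm,
      l2Class_congr (hφ.weakPartial_ae_eq ho i)] at h
    rw [l2Class_coe, l2Class_coe, h, neg_neg]
  have hjet : weakJet Ω f.fst = f := by
    rw [weakJet, jet_congr (.refl _ _) fun i => (hpartial i).weakPartial_ae_eq ho]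
    simp only [jet, l2Class_coe]
    rfl
  exact ⟨f.fst, (memH10_iff_weakJet_mem ho).2
    ⟨⟨memL2_coe _, fun i => ⟨_, memL2_coe _, hpartial i⟩⟩, hjet.symm ▸ hf⟩, hjet⟩

theorem MemH10.inner_weakPartial_left (ho : IsOpen Ω) (hu : MemH10 Ω u) (hv : MemH1 Ω v)
    (i : Fin 3) :
    inner ℂ (l2Class Ω (weakPartial Ω i u)) (l2Class Ω v)
      = -inner ℂ (l2Class Ω u) (l2Class Ω (weakPartial Ω i v)) :=
  inner_snd_eq_neg_inner_fst ho hv i ((memH10_iff_weakJet_mem ho).1 hu).2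

theorem MemH10.inner_weakPartial_swap (ho : IsOpen Ω) (hu : MemH10 Ω u) (hv : MemH1 Ω v)
    (i j : Fin 3) :
    inner ℂ (l2Class Ω (weakPartial Ω i u)) (l2Class Ω (weakPartial Ω j v))
      = inner ℂ (l2Class Ω (weakPartial Ω j u)) (l2Class Ω (weakPartial Ω i v)) :=
  inner_snd_swap ho hv i j ((memH10_iff_weakJet_mem ho).1 hu).2

theorem l2NormSq_nonneg (u : E3 → ℂ) : 0 ≤ l2NormSq Ω u :=
  integral_nonneg fun _ => sq_nonneg _

theorem l2NormSq_congr (h : u =ᵐ[volume.restrict Ω] v) : l2NormSq Ω u = l2NormSq Ω v :=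
  integral_congr_ae (h.mono fun _ hx => congrArg (‖·‖ ^ 2) hx)

theorem h1NormSq_congr (h : u =ᵐ[volume.restrict Ω] v) : h1NormSq Ω u = h1NormSq Ω v := by
  simp only [h1NormSq, l2NormSq_congr h, weakPartial_congr h]

theorem h1NormSq_weakPartial_le_h2NormSq (u : E3 → ℂ) (j : Fin 3) :
    h1NormSq Ω (weakPartial Ω j u) ≤ h2NormSq Ω u := by
  rw [h1NormSq, h2NormSq, Finset.sum_comm]
  have hfirst := Finset.single_le_sum (f := fun j => l2NormSq Ω (weakPartial Ω j u))
    (fun _ _ => l2NormSq_nonneg _) (Finset.mem_univ j)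
  have hsecond := Finset.single_le_sum
    (f := fun j => ∑ i, l2NormSq Ω (weakPartial Ω i (weakPartial Ω j u)))
    (fun _ _ => Finset.sum_nonneg fun _ _ => l2NormSq_nonneg _) (Finset.mem_univ j)
  linarith [l2NormSq_nonneg (Ω := Ω) u]

theorem MemH20.memH10 (h : MemH20 Ω u) : MemH10 Ω u := by
  refine ⟨h.1.1, fun ε hε => ?_⟩
  obtain ⟨φ, hφ, hlt⟩ := h.2 ε hε
  exact ⟨φ, hφ, (le_add_of_nonneg_right (Finset.sum_nonneg fun _ _ =>
    Finset.sum_nonneg fun _ _ => l2NormSq_nonneg _)).trans_lt hlt⟩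

theorem MemH20.memH10_weakPartial (ho : IsOpen Ω) (h : MemH20 Ω u) (j : Fin 3) :
    MemH10 Ω (weakPartial Ω j u) := by
  refine ⟨h.1.2 j, fun ε hε => ?_⟩
  obtain ⟨φ, hφ, hlt⟩ := h.2 ε hε
  have hsub : weakPartial Ω j u - classicalPartial j φ
      =ᵐ[volume.restrict Ω] weakPartial Ω j (u - φ) :=
    (((h.1.1.hasWeakPartial j).sub (hφ.hasWeakPartial j)).weakPartial_ae_eq ho).symm
  refine ⟨classicalPartial j φ, hφ.partial j, ?_⟩
  rw [h1NormSq_congr hsub]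
  exact (h1NormSq_weakPartial_le_h2NormSq (u - φ) j).trans_lt hlt

end Jets

section Rellich

open scoped SchwartzMap FourierTransform LineDeriv

theorem exists_finset_forall_norm_inner_sq_le {𝕜 E : Type*} [RCLike 𝕜] [NormedAddCommGroup E]
    [InnerProductSpace 𝕜 E] {K : Set E} (hK : IsCompact K) {δ : ℝ} (hδ : 0 < δ) :
    ∃ s : Finset E, ∀ g ∈ K, ∀ x : E,
      ‖inner 𝕜 g x‖ ^ 2 ≤ 2 * ∑ h ∈ s, ‖inner 𝕜 h x‖ ^ 2 + 2 * δ ^ 2 * ‖x‖ ^ 2 := by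
  obtain ⟨t, -, ht, hcover⟩ := hK.finite_cover_balls hδ
  refine ⟨ht.toFinset, fun g hg x => ?_⟩
  obtain ⟨h, hht, hgh⟩ := Set.mem_iUnion₂.1 (hcover hg)
  rw [Metric.mem_ball, dist_eq_norm] at hgh
  have hsum : ‖inner 𝕜 h x‖ ^ 2 ≤ ∑ h ∈ ht.toFinset, ‖inner 𝕜 h x‖ ^ 2 :=
    Finset.single_le_sum (f := fun h => ‖inner 𝕜 h x‖ ^ 2) (fun _ _ => sq_nonneg _)
      (ht.mem_toFinset.2 hht)
  have htriangle : ‖inner 𝕜 g x‖ ≤ ‖inner 𝕜 h x‖ + δ * ‖x‖ := by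
    rw [← add_sub_cancel h g, inner_add_left]
    exact (norm_add_le _ _).trans
      (add_le_add_right ((norm_inner_le_norm _ _).trans (by gcongr)) _)
  calc ‖inner 𝕜 g x‖ ^ 2 ≤ (‖inner 𝕜 h x‖ + δ * ‖x‖) ^ 2 := by gcongr
    _ ≤ 2 * (‖inner 𝕜 h x‖ ^ 2 + (δ * ‖x‖) ^ 2) := add_sq_le
    _ ≤ _ := by rw [mul_pow]; linarith

theorem integral_norm_sq_le_of_forall_mem_closedBall {E F : Type*} [NormedAddCommGroup E]
    [ProperSpace E] [MeasurableSpace E] [OpensMeasurableSpace E] [NormedAddCommGroup F]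
    {μ : Measure E} [IsFiniteMeasureOnCompacts μ] {f : E → F} {R M : ℝ}
    (hf : Integrable (fun x => ‖f x‖ ^ 2) μ) (hxf : Integrable (fun x => ‖x‖ ^ 2 * ‖f x‖ ^ 2) μ)
    (hR : 0 < R) (hM : ∀ x ∈ Metric.closedBall 0 R, ‖f x‖ ^ 2 ≤ M) :
    ∫ x, ‖f x‖ ^ 2 ∂μ
      ≤ (R ^ 2)⁻¹ * ∫ x, ‖x‖ ^ 2 * ‖f x‖ ^ 2 ∂μ + μ.real (Metric.closedBall 0 R) * M := by
  have hball : MeasurableSet (Metric.closedBall (0 : E) R) :=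
    Metric.isClosed_closedBall.measurableSet
  have hind : Integrable ((Metric.closedBall 0 R).indicator fun _ : E => M) μ :=
    (integrable_indicator_iff hball).2
      (integrableOn_const (isCompact_closedBall (0 : E) R).measure_ne_top)
  rw [← smul_eq_mul (μ.real _), ← integral_indicator_const M hball, ← integral_const_mul,
    ← integral_add (hxf.const_mul _) hind]
  refine integral_mono hf ((hxf.const_mul _).add hind) fun x => ?_
  by_cases hx : x ∈ Metric.closedBall 0 R
  · rw [Set.indicator_of_mem hx]
    exact (hM x hx).trans (le_add_of_nonneg_left (by positivity))
  · rw [Set.indicator_of_notMem hx, add_zero, ← mul_assoc]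
    have hRx : R < ‖x‖ := by simpa using hx
    refine le_mul_of_one_le_left (sq_nonneg _) ?_
    rw [← div_eq_inv_mul, one_le_div (by positivity)]
    gcongr

variable {Ω : Set E3} {φ : E3 → ℂ}

theorem integrable_norm_sq_schwartz (s : 𝓢(E3, ℂ)) : Integrable fun x => ‖s x‖ ^ 2 :=
  (memLp_two_iff_integrable_sq_norm s.continuous.aestronglyMeasurable).1 (s.memLp 2)

/-- A test function as a Schwartz function. -/
def IsTestFunction.toSchwartz (h : IsTestFunction Ω φ) : 𝓢(E3, ℂ) :=
  h.2.1.toSchwartzMap h.1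

theorem IsTestFunction.toSchwartz_apply (h : IsTestFunction Ω φ) (x : E3) :
    h.toSchwartz x = φ x := rfl

theorem IsTestFunction.lineDeriv_toSchwartz (h : IsTestFunction Ω φ) (i : Fin 3) :
    ∂_{(EuclideanSpace.single i (1 : ℝ) : E3)} h.toSchwartz = (h.partial i).toSchwartz := by
  ext x
  rw [SchwartzMap.lineDerivOp_apply_eq_fderiv]
  rfl

theorem IsTestFunction.integral_norm_sq_fourier (h : IsTestFunction Ω φ) :
    ∫ ξ, ‖𝓕 h.toSchwartz ξ‖ ^ 2 = ‖l2Class Ω φ‖ ^ 2 := by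
  rw [SchwartzMap.integral_norm_sq_fourier, norm_sq_l2Class h.memL2, l2NormSq]
  exact (setIntegral_eq_integral_of_forall_compl_eq_zero fun x hx => by
    simp [h.toSchwartz_apply, h.eq_zero_of_notMem hx]).symm

theorem IsTestFunction.norm_sq_fourier_partial (h : IsTestFunction Ω φ) (i : Fin 3) (ξ : E3) :
    ‖𝓕 (h.partial i).toSchwartz ξ‖ ^ 2
      = (2 * Real.pi) ^ 2 * (ξ i ^ 2 * ‖𝓕 h.toSchwartz ξ‖ ^ 2) := by
  have hgrowth :
      (fun x : E3 => inner ℝ x (EuclideanSpace.single i (1 : ℝ))).HasTemperateGrowth := by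
    fun_prop
  have hinner : inner ℝ ξ (EuclideanSpace.single i (1 : ℝ)) = ξ i := by
    simp [EuclideanSpace.inner_single_right]
  rw [← h.lineDeriv_toSchwartz, SchwartzMap.fourier_lineDerivOp_eq]
  simp only [smul_apply, SchwartzMap.smulLeftCLM_apply_apply hgrowth, norm_smul, hinner]
  simp [abs_of_pos Real.pi_pos, mul_pow]

theorem IsTestFunction.norm_sq_mul_norm_sq_fourier (h : IsTestFunction Ω φ) (ξ : E3) :
    ‖ξ‖ ^ 2 * ‖𝓕 h.toSchwartz ξ‖ ^ 2
      = ((2 * Real.pi) ^ 2)⁻¹ * ∑ i, ‖𝓕 (h.partial i).toSchwartz ξ‖ ^ 2 := by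
  simp only [h.norm_sq_fourier_partial, EuclideanSpace.norm_sq_eq, Real.norm_eq_abs, sq_abs,
    ← Finset.mul_sum, ← Finset.sum_mul]
  rw [inv_mul_cancel_left₀ (by positivity)]

theorem IsTestFunction.integrable_norm_sq_mul_norm_sq_fourier (h : IsTestFunction Ω φ) :
    Integrable fun ξ : E3 => ‖ξ‖ ^ 2 * ‖𝓕 h.toSchwartz ξ‖ ^ 2 := by
  simp only [h.norm_sq_mul_norm_sq_fourier]
  exact (integrable_finsetSum _ fun _ _ => integrable_norm_sq_schwartz _).const_mul _

theorem IsTestFunction.integral_norm_sq_mul_norm_sq_fourier_le (h : IsTestFunction Ω φ) :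
    ∫ ξ : E3, ‖ξ‖ ^ 2 * ‖𝓕 h.toSchwartz ξ‖ ^ 2 ≤ ∑ i, ‖l2Class Ω (classicalPartial i φ)‖ ^ 2 := by
  simp only [h.norm_sq_mul_norm_sq_fourier, ← (h.partial _).integral_norm_sq_fourier]
  rw [integral_const_mul, integral_finsetSum _ fun _ _ => integrable_norm_sq_schwartz _]
  refine mul_le_of_le_one_left (Finset.sum_nonneg fun _ _ => integral_nonneg fun _ => sq_nonneg _)
    (inv_le_one_of_one_le₀ ?_)
  nlinarith [Real.pi_gt_three]

/-- The plane wave `x ↦ exp (2πi x · ξ)` of frequency `ξ`. -/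
def planeWave (ξ x : E3) : ℂ := Real.fourierChar (inner ℝ x ξ)

theorem norm_planeWave (ξ x : E3) : ‖planeWave ξ x‖ = 1 := Circle.norm_coe _

theorem continuous_planeWave : Continuous (Function.uncurry planeWave) :=
  continuous_subtype_val.comp (Real.continuous_fourierChar.comp (by fun_prop))

theorem memL2_planeWave (hb : Bornology.IsBounded Ω) (ξ : E3) : MemL2 Ω (planeWave ξ) := by
  have : IsFiniteMeasure (volume.restrict Ω) := isFiniteMeasure_restrict.2 hb.measure_lt_top.ne
  exact MemLp.of_bound
    (continuous_planeWave.uncurry_left ξ).aestronglyMeasurable 1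
    (ae_of_all _ fun x => (norm_planeWave ξ x).le)

theorem IsTestFunction.fourier_eq_inner_planeWave (hb : Bornology.IsBounded Ω)
    (h : IsTestFunction Ω φ) (ξ : E3) :
    𝓕 h.toSchwartz ξ = inner ℂ (l2Class Ω (planeWave ξ)) (l2Class Ω φ) := by
  rw [inner_l2Class (memL2_planeWave hb ξ) h.memL2, SchwartzMap.fourier_coe, Real.fourier_eq,
    ← setIntegral_eq_integral_of_forall_compl_eq_zero (s := Ω) fun x hx => by
      rw [h.toSchwartz_apply, h.eq_zero_of_notMem hx, smul_zero]]
  simp only [h.toSchwartz_apply, planeWave, AddChar.map_neg_eq_inv, Circle.smul_def,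
    Circle.coe_inv_eq_conj, smul_eq_mul, mul_comm]

theorem continuous_l2NormSq_planeWave_sub (hb : Bornology.IsBounded Ω) (η : E3) :
    Continuous fun ξ => l2NormSq Ω (planeWave ξ - planeWave η) := by
  have : IsFiniteMeasure (volume.restrict Ω) := isFiniteMeasure_restrict.2 hb.measure_lt_top.ne
  refine continuous_of_dominated (bound := fun _ => (1 + 1) ^ 2)
    (fun ξ => (((continuous_planeWave.uncurry_left ξ).sub
      (continuous_planeWave.uncurry_left η)).norm.pow 2).aestronglyMeasurable)
    (fun ξ => ae_of_all _ fun x => ?_) (integrable_const _)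
    (ae_of_all _ fun x => ((continuous_planeWave.uncurry_right x).sub continuous_const).norm.pow 2)
  rw [norm_pow, norm_norm]
  gcongr
  exact (norm_sub_le _ _).trans (by simp only [norm_planeWave, le_refl])

theorem continuous_l2Class_planeWave (hb : Bornology.IsBounded Ω) :
    Continuous fun ξ => l2Class Ω (planeWave ξ) := by
  refine continuous_iff_continuousAt.2 fun η => tendsto_iff_norm_sub_tendsto_zero.2 ?_
  have hsq : ∀ ξ, ‖l2Class Ω (planeWave ξ) - l2Class Ω (planeWave η)‖
      = √(l2NormSq Ω (planeWave ξ - planeWave η)) := fun ξ => by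
    have hξ := memL2_planeWave hb ξ
    have hη := memL2_planeWave hb η
    rw [← l2Class_sub hξ hη, ← norm_sq_l2Class (hξ.sub hη), Real.sqrt_sq (norm_nonneg _)]
  simp only [hsq]
  refine ((continuous_l2NormSq_planeWave_sub hb η).sqrt.tendsto η).trans_eq ?_
  simp [l2NormSq]

/-- Low frequencies form a compact set of plane waves, so they are seen by finitely many
functionals; high frequencies are controlled by the gradient. -/
theorem exists_finset_norm_sq_l2Class_le (hb : Bornology.IsBounded Ω) {ε : ℝ} (hε : 0 < ε) :
    ∃ (s : Finset (L2Space Ω)) (C : ℝ), ∀ φ, IsTestFunction Ω φ →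
      ‖l2Class Ω φ‖ ^ 2 ≤ ε * ‖jet Ω φ fun i => classicalPartial i φ‖ ^ 2
        + C * ∑ g ∈ s, ‖inner ℂ g (l2Class Ω φ)‖ ^ 2 := by
  set R : ℝ := √ε⁻¹
  have hR : 0 < R := Real.sqrt_pos.2 (inv_pos.2 hε)
  have hRε : (R ^ 2)⁻¹ = ε := by rw [Real.sq_sqrt (inv_pos.2 hε).le, inv_inv]
  set V : ℝ := volume.real (Metric.closedBall (0 : E3) R)
  have : 0 ≤ V := measureReal_nonneg
  obtain ⟨δ, hδ, hVδ⟩ : ∃ δ : ℝ, 0 < δ ∧ V * (2 * δ ^ 2) ≤ ε := by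
    refine ⟨√(ε / (2 * V + 1)), Real.sqrt_pos.2 (by positivity), ?_⟩
    rw [Real.sq_sqrt (by positivity), mul_div_assoc', mul_div_assoc', div_le_iff₀ (by positivity)]
    linarith
  obtain ⟨s, hs⟩ := exists_finset_forall_norm_inner_sq_le (𝕜 := ℂ)
    ((isCompact_closedBall (0 : E3) R).image (continuous_l2Class_planeWave hb)) hδ
  refine ⟨s, 2 * V, fun φ hφ => ?_⟩
  have hlow : ∀ ξ ∈ Metric.closedBall 0 R, ‖𝓕 hφ.toSchwartz ξ‖ ^ 2
      ≤ 2 * ∑ g ∈ s, ‖inner ℂ g (l2Class Ω φ)‖ ^ 2 + 2 * δ ^ 2 * ‖l2Class Ω φ‖ ^ 2 :=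
    fun ξ hξ => by
      rw [hφ.fourier_eq_inner_planeWave hb]
      exact hs _ (Set.mem_image_of_mem _ hξ) _
  have hsplit := integral_norm_sq_le_of_forall_mem_closedBall (integrable_norm_sq_schwartz _)
    hφ.integrable_norm_sq_mul_norm_sq_fourier hR hlow
  rw [hφ.integral_norm_sq_fourier, hRε] at hsplit
  have hhigh := mul_le_mul_of_nonneg_left hφ.integral_norm_sq_mul_norm_sq_fourier_le hε.le
  have hsmall := mul_le_mul_of_nonneg_right hVδ (sq_nonneg ‖l2Class Ω φ‖)
  rw [norm_sq_jet]
  linarith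

theorem exists_finset_norm_fst_sq_le (hb : Bornology.IsBounded Ω) {ε : ℝ} (hε : 0 < ε) :
    ∃ (s : Finset (L2Space Ω)) (C : ℝ), ∀ f ∈ h10Space Ω,
      ‖f.fst‖ ^ 2 ≤ ε * ‖f‖ ^ 2 + C * ∑ g ∈ s, ‖inner ℂ g f.fst‖ ^ 2 := by
  obtain ⟨s, C, hsC⟩ := exists_finset_norm_sq_l2Class_le hb hε
  exact ⟨s, C, fun f hf => h10Space_induction (p := fun f => ‖f.fst‖ ^ 2
    ≤ ε * ‖f‖ ^ 2 + C * ∑ g ∈ s, ‖inner ℂ g f.fst‖ ^ 2)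
    (isClosed_le (by fun_prop) (by fun_prop)) hsC hf⟩

end Rellich

section Poincare

variable {Ω : Set E3} {u v : E3 → ℂ}

theorem integral_sum_weakPartial_mul_conj (ho : IsOpen Ω) (hu : MemH1 Ω u) (hv : MemH1 Ω v) :
    ∫ x in Ω, ∑ i, weakPartial Ω i u x * conj (weakPartial Ω i v x)
      = inner ℂ (weakJet Ω v).snd (weakJet Ω u).snd := by
  rw [integral_finsetSum _ fun i _ =>
    integrable_mul_conj (hv.memL2_weakPartial ho i) (hu.memL2_weakPartial ho i), PiLp.inner_apply]
  exact Finset.sum_congr rfl fun i _ =>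
    (inner_l2Class (hv.memL2_weakPartial ho i) (hu.memL2_weakPartial ho i)).symm

theorem IsDirichletEigenvalue.nonneg (ho : IsOpen Ω) {Λ : ℝ} (h : IsDirichletEigenvalue Ω Λ) :
    0 ≤ Λ := by
  obtain ⟨w, hw, hw0, heq⟩ := h
  have hgrad := heq w hw
  rw [integral_sum_weakPartial_mul_conj ho hw.1 hw.1, ← inner_l2Class hw.1.1 hw.1.1] at hgrad
  have hne : l2Class Ω w ≠ 0 := fun hzero =>
    hw0 (hw.1.1.l2Class_ae_eq.symm.trans (hzero ▸ Lp.coeFn_zero _ _ _))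
  have hrayleigh : ‖(weakJet Ω w).snd‖ ^ 2 = Λ * ‖l2Class Ω w‖ ^ 2 := by
    have hre := congrArg Complex.re hgrad
    rwa [Complex.re_ofReal_mul, ← RCLike.re_to_complex, ← RCLike.re_to_complex,
      inner_self_eq_norm_sq, inner_self_eq_norm_sq] at hre
  exact nonneg_of_mul_nonneg_left (hrayleigh ▸ sq_nonneg _) (by positivity)

/-- The variational equation `⟪f, w⟫_{L²} = κ ⟪f, w⟫_{H¹}` is the Dirichlet eigenvalue equation,
since the `H¹` inner product is the sum of the `L²` inner products of functions and gradients. -/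
theorem isDirichletEigenvalue_inv_sub_one (ho : IsOpen Ω) {κ : ℝ} (hκ : κ ≠ 0) {w : JetSpace Ω}
    (hw : w ∈ h10Space Ω) (hw0 : w ≠ 0)
    (heq : ∀ f ∈ h10Space Ω, inner ℂ f.fst w.fst = (κ : ℂ) * inner ℂ f w) :
    IsDirichletEigenvalue Ω (κ⁻¹ - 1) := by
  have hκ' : (κ : ℂ) ≠ 0 := Complex.ofReal_ne_zero.2 hκ
  obtain ⟨u, hu, rfl⟩ := exists_memH10_weakJet_eq ho hw
  refine ⟨u, hu, fun hzero => hw0 ?_, fun v hv => ?_⟩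
  · have hfst : (weakJet Ω u).fst = 0 :=
      (l2Class_congr hzero).trans (by simp [l2Class])
    have := heq _ hw
    rw [hfst, inner_zero_left, zero_eq_mul] at this
    exact inner_self_eq_zero.1 (this.resolve_left hκ')
  · have hvu := heq _ ((memH10_iff_weakJet_mem ho).1 hv).2
    rw [WithLp.prod_inner_apply] at hvu
    rw [integral_sum_weakPartial_mul_conj ho hu.1 hv.1, ← inner_l2Class hv.1.1 hu.1.1]
    change _ = _ * inner ℂ (weakJet Ω v).fst (weakJet Ω u).fst
    push_cast
    rw [sub_mul, one_mul, eq_sub_iff_add_eq', eq_inv_mul_iff_mul_eq₀ hκ']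
    exact hvu.symm

theorem firstDirichletEigenvalue_le (ho : IsOpen Ω) {Λ : ℝ} (h : IsDirichletEigenvalue Ω Λ) :
    firstDirichletEigenvalue Ω ≤ Λ :=
  csInf_le ⟨0, fun _ hΛ => IsDirichletEigenvalue.nonneg ho hΛ⟩ h

theorem firstDirichletEigenvalue_nonneg (ho : IsOpen Ω) : 0 ≤ firstDirichletEigenvalue Ω :=
  Real.sInf_nonneg fun _ hΛ => IsDirichletEigenvalue.nonneg ho hΛ

theorem firstDirichletEigenvalue_mul_norm_fst_sq_le (hb : Bornology.IsBounded Ω) (ho : IsOpen Ω)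
    {f : JetSpace Ω} (hf : f ∈ h10Space Ω) :
    firstDirichletEigenvalue Ω * ‖f.fst‖ ^ 2 ≤ ‖f.snd‖ ^ 2 := by
  rcases eq_or_ne f.fst 0 with hfst | hfst
  · rw [hfst, norm_zero, zero_pow two_ne_zero, mul_zero]
    exact sq_nonneg _
  · obtain ⟨κ, hκ, hmax, w, hw, hw0, heq⟩ := exists_top_singular_vector_of_mem
      (J := WithLp.fstL 2 ℂ (L2Space Ω) (PiLp 2 fun _ : Fin 3 => L2Space Ω))
      (fun _ => exists_finset_norm_fst_sq_le hb) hf hfst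
    have hfirst : firstDirichletEigenvalue Ω ≤ κ⁻¹ - 1 :=
      firstDirichletEigenvalue_le ho (isDirichletEigenvalue_inv_sub_one ho hκ.ne' hw hw0 heq)
    have hnorm : ‖f.fst‖ ^ 2 ≤ κ * ‖f‖ ^ 2 := hmax f hf
    rw [WithLp.prod_norm_sq_eq_of_L2, ← inv_mul_le_iff₀ hκ] at hnorm
    linarith [mul_le_mul_of_nonneg_right hfirst (sq_nonneg ‖f.fst‖)]

theorem MemH10.firstDirichletEigenvalue_mul_norm_sq_le (hb : Bornology.IsBounded Ω)
    (ho : IsOpen Ω) (hu : MemH10 Ω u) :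
    firstDirichletEigenvalue Ω * ‖l2Class Ω u‖ ^ 2
      ≤ ∑ i, ‖l2Class Ω (weakPartial Ω i u)‖ ^ 2 :=
  (firstDirichletEigenvalue_mul_norm_fst_sq_le hb ho ((memH10_iff_weakJet_mem ho).1 hu).2).trans_eq
    (PiLp.norm_sq_eq_of_L2 _ _)

end Poincare

section VectorFields

variable {Ω : Set E3} {u w : VField}

theorem memL2_sum {ι : Type*} (s : Finset ι) {f : ι → E3 → ℂ} (h : ∀ a ∈ s, MemL2 Ω (f a)) :
    MemL2 Ω (∑ a ∈ s, f a) :=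
  memLp_finsetSum' s h

theorem l2Class_sum {ι : Type*} (s : Finset ι) {f : ι → E3 → ℂ} (h : ∀ a ∈ s, MemL2 Ω (f a)) :
    l2Class Ω (∑ a ∈ s, f a) = ∑ a ∈ s, l2Class Ω (f a) := by
  classical
  induction s using Finset.induction_on with
  | empty => simp [l2Class]
  | insert a s ha ih =>
    have hs : ∀ b ∈ s, MemL2 Ω (f b) := fun b hb => h b (Finset.mem_insert_of_mem hb)
    rw [Finset.sum_insert ha, Finset.sum_insert ha,
      l2Class_add (h a (Finset.mem_insert_self a s)) (memL2_sum s hs), ih hs]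

/-- `‖w‖²` in `L²(Ω)³`. -/
def vecNormSq (Ω : Set E3) (w : VField) : ℝ :=
  ∑ a, ‖l2Class Ω (w a)‖ ^ 2

/-- `‖∇u‖²` in `L²(Ω)`. -/
def gradNormSq (Ω : Set E3) (u : VField) : ℝ :=
  ∑ a, ∑ i, ‖l2Class Ω (weakPartial Ω i (u a))‖ ^ 2

/-- `‖∇²u‖²` in `L²(Ω)`, the sum over all second partial derivatives. -/
def hessNormSq (Ω : Set E3) (u : VField) : ℝ :=
  ∑ a, ∑ i, ∑ j, ‖l2Class Ω (weakPartial Ω i (weakPartial Ω j (u a)))‖ ^ 2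

theorem vecNormSq_nonneg (Ω : Set E3) (w : VField) : 0 ≤ vecNormSq Ω w :=
  Finset.sum_nonneg fun _ _ => sq_nonneg _

theorem h2NormSqVec_eq (ho : IsOpen Ω) (hu : ∀ a, MemH2 Ω (u a)) :
    h2NormSqVec Ω u = vecNormSq Ω u + gradNormSq Ω u + hessNormSq Ω u := by
  simp only [vecNormSq, gradNormSq, hessNormSq, ← Finset.sum_add_distrib]
  refine Finset.sum_congr rfl fun a _ => ?_
  simp only [h2NormSq, norm_sq_l2Class (hu a).1.1,
    norm_sq_l2Class ((hu a).1.memL2_weakPartial ho _),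
    norm_sq_l2Class (((hu a).2 _).memL2_weakPartial ho _)]

theorem firstDirichletEigenvalue_mul_vecNormSq_le (hb : Bornology.IsBounded Ω) (ho : IsOpen Ω)
    (hu : ∀ a, MemH10 Ω (u a)) :
    firstDirichletEigenvalue Ω * vecNormSq Ω u ≤ gradNormSq Ω u := by
  rw [vecNormSq, gradNormSq, Finset.mul_sum]
  exact Finset.sum_le_sum fun a _ => (hu a).firstDirichletEigenvalue_mul_norm_sq_le hb ho

theorem integrable_norm_sq (hw : ∀ a, MemL2 Ω (w a)) (a : Fin 3) :
    Integrable (fun x => ‖w a x‖ ^ 2) (volume.restrict Ω) :=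
  (memLp_two_iff_integrable_sq_norm (hw a).1).1 (hw a)

theorem vecNormSq_eq_integral (hw : ∀ a, MemL2 Ω (w a)) :
    vecNormSq Ω w = ∫ x in Ω, ∑ a, ‖w a x‖ ^ 2 := by
  rw [integral_finsetSum _ fun a _ => integrable_norm_sq hw a]
  exact Finset.sum_congr rfl fun a _ => norm_sq_l2Class (hw a)

theorem mul_vecNormSq_le_integral (hw : ∀ a, MemL2 Ω (w a)) {κ : E3 → ℝ} {c B : ℝ}
    (hκ : AEStronglyMeasurable κ (volume.restrict Ω))
    (hB : ∀ᵐ x ∂(volume.restrict Ω), ‖κ x‖ ≤ B) (hc : ∀ᵐ x ∂(volume.restrict Ω), c ≤ κ x) :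
    c * vecNormSq Ω w ≤ ∫ x in Ω, κ x * ∑ a, ‖w a x‖ ^ 2 := by
  have hint : Integrable (fun x => ∑ a, ‖w a x‖ ^ 2) (volume.restrict Ω) :=
    integrable_finsetSum _ fun a _ => integrable_norm_sq hw a
  rw [vecNormSq_eq_integral hw, ← integral_const_mul]
  refine integral_mono_ae (hint.const_mul c) (hint.bdd_mul hκ hB) ?_
  filter_upwards [hc] with x hx
  exact mul_le_mul_of_nonneg_right hx (by positivity)

theorem integral_ofReal_mul_sum_mul_conj_self (Ω : Set E3) (κ : E3 → ℝ) (w : VField) :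
    ∫ x in Ω, (κ x : ℂ) * ∑ a, w a x * conj (w a x)
      = ((∫ x in Ω, κ x * ∑ a, ‖w a x‖ ^ 2 : ℝ) : ℂ) := by
  rw [← integral_complex_ofReal]
  simp only [Complex.mul_conj']
  push_cast
  rfl

theorem integral_sum_mul_conj_self (hw : ∀ a, MemL2 Ω (w a)) :
    ∫ x in Ω, ∑ a, w a x * conj (w a x) = (vecNormSq Ω w : ℂ) := by
  simpa [vecNormSq_eq_integral hw] using integral_ofReal_mul_sum_mul_conj_self Ω 1 w

end VectorFields

section Lame

variable {Ω : Set E3} {lam mu : ℝ} {u : VField}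

/-- The elastic energy `∫ ∇u : C : ∇ū`; on `H¹₀(Ω)³` integration by parts turns it into
`μ ‖∇u‖² + (λ + μ) ‖∇ · u‖²`, which is taken as the definition. -/
def elasticEnergy (lam mu : ℝ) (Ω : Set E3) (u : VField) : ℝ :=
  mu * gradNormSq Ω u + (lam + mu) * ‖∑ i, l2Class Ω (weakPartial Ω i (u i))‖ ^ 2

theorem min_mul_gradNormSq_le_elasticEnergy (ho : IsOpen Ω) (hu : ∀ a, MemH10 Ω (u a)) :
    min mu (lam + 2 * mu) * gradNormSq Ω u ≤ elasticEnergy lam mu Ω u := by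
  refine (min_mul_le_mul_sub_add_mul (sq_nonneg _) (norm_sum_diag_sq_le (𝕜 := ℂ)
    fun a b i j => (hu a).inner_weakPartial_swap ho (hu b).1 i j)).trans_eq ?_
  rw [elasticEnergy, gradNormSq]
  ring

theorem sum_moduli_mul (lam mu : ℝ) (T : Fin 3 → Fin 3 → Fin 3 → Fin 3 → ℂ) :
    ∑ i, ∑ j, ∑ k, ∑ l, (moduli lam mu i j k l : ℂ) * T i j k l
      = lam * ∑ i, ∑ k, T i i k k + mu * (∑ i, ∑ j, T i j i j + ∑ i, ∑ j, T i j j i) := by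
  simp only [Fin.sum_univ_three, moduli, kron]
  simp
  ring

theorem sum_moduli_mul_inner {E : Type*} [NormedAddCommGroup E] [InnerProductSpace ℂ E]
    (lam mu : ℝ) {x : Fin 3 → Fin 3 → E}
    (hx : ∀ a b i j, inner ℂ (x a i) (x b j) = inner ℂ (x a j) (x b i)) :
    ∑ i, ∑ j, ∑ k, ∑ l, (moduli lam mu i j k l : ℂ) * inner ℂ (x k l) (x i j)
      = ((mu * ∑ a, ∑ i, ‖x a i‖ ^ 2 + (lam + mu) * ‖∑ i, x i i‖ ^ 2 : ℝ) : ℂ) := by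
  have hself : ∀ v : E, inner ℂ v v = ((‖v‖ ^ 2 : ℝ) : ℂ) := fun v => by
    rw [inner_self_eq_norm_sq_to_K]
    norm_cast
  have hdiv : ∑ i, ∑ k, inner ℂ (x k k) (x i i) = ((‖∑ i, x i i‖ ^ 2 : ℝ) : ℂ) := by
    rw [← hself, inner_sum]
    simp only [sum_inner]
  have hswap : ∑ i, ∑ j, inner ℂ (x j i) (x i j) = ∑ i, ∑ k, inner ℂ (x k k) (x i i) :=
    Finset.sum_congr rfl fun i _ => Finset.sum_congr rfl fun j _ => hx _ _ _ _
  rw [sum_moduli_mul lam mu fun i j k l => inner ℂ (x k l) (x i j), hswap, hdiv]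
  simp only [hself]
  push_cast
  ring

theorem integral_moduli_eq_elasticEnergy (ho : IsOpen Ω) (hu : ∀ a, MemH10 Ω (u a)) :
    ∫ x in Ω, ∑ i, ∑ j, ∑ k, ∑ l,
        weakPartial Ω j (u i) x * (moduli lam mu i j k l : ℂ) * conj (weakPartial Ω l (u k) x)
      = (elasticEnergy lam mu Ω u : ℂ) := by
  have hgrad : ∀ a i, MemL2 Ω (weakPartial Ω i (u a)) := fun a i => (hu a).1.memL2_weakPartial ho i
  have hint : ∀ i j k l, Integrable (fun x => (moduli lam mu i j k l : ℂ) *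
      (weakPartial Ω j (u i) x * conj (weakPartial Ω l (u k) x))) (volume.restrict Ω) :=
    fun i j k l => (integrable_mul_conj (hgrad k l) (hgrad i j)).const_mul _
  rw [elasticEnergy, gradNormSq, ← sum_moduli_mul_inner lam mu
    (x := fun a i => l2Class Ω (weakPartial Ω i (u a)))
    fun a b i j => (hu a).inner_weakPartial_swap ho (hu b).1 i j]
  simp only [mul_comm (weakPartial Ω _ (u _) _) (moduli _ _ _ _ _ _ : ℂ), mul_assoc]
  simp (maxDischargeDepth := 8) only [integral_finsetSum, integrable_finsetSum, hint, implies_true,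
    integral_const_mul, inner_l2Class, hgrad]

theorem hasWeakPartial_divergence (hu : ∀ a, MemH2 Ω (u a)) (i : Fin 3) :
    HasWeakPartial Ω i (divergence Ω u) (∑ j, weakPartial Ω i (weakPartial Ω j (u j))) := by
  have hdiv : divergence Ω u = ∑ j, weakPartial Ω j (u j) := by
    ext x
    simp only [divergence, Finset.sum_apply]
  rw [hdiv]
  exact .sum _ fun j _ => ((hu j).2 j).hasWeakPartial i

theorem lame_ae_eq (lam mu : ℝ) (ho : IsOpen Ω) (hu : ∀ a, MemH2 Ω (u a)) (a : Fin 3) :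
    lame lam mu Ω u a =ᵐ[volume.restrict Ω]
      (mu : ℂ) • ∑ j, weakPartial Ω j (weakPartial Ω j (u a))
        + ((lam + mu : ℝ) : ℂ) • ∑ j, weakPartial Ω a (weakPartial Ω j (u j)) := by
  filter_upwards [(hasWeakPartial_divergence hu a).weakPartial_ae_eq ho] with x hx
  simp only [lame, hx, Pi.add_apply, Pi.smul_apply, Finset.sum_apply, smul_eq_mul]

theorem memL2_lame (lam mu : ℝ) (ho : IsOpen Ω) (hu : ∀ a, MemH2 Ω (u a)) (a : Fin 3) :
    MemL2 Ω (lame lam mu Ω u a) :=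
  MemLp.ae_eq (lame_ae_eq lam mu ho hu a).symm <|
    ((memL2_sum _ fun j _ => ((hu a).2 j).memL2_weakPartial ho j).const_smul _).add
      ((memL2_sum _ fun j _ => ((hu j).2 j).memL2_weakPartial ho a).const_smul _)

theorem l2Class_lame (lam mu : ℝ) (ho : IsOpen Ω) (hu : ∀ a, MemH2 Ω (u a)) (a : Fin 3) :
    l2Class Ω (lame lam mu Ω u a)
      = (mu : ℂ) • ∑ j, l2Class Ω (weakPartial Ω j (weakPartial Ω j (u a)))
        + ((lam + mu : ℝ) : ℂ) • ∑ j, l2Class Ω (weakPartial Ω a (weakPartial Ω j (u j))) := by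
  have hlap : ∀ j ∈ Finset.univ, MemL2 Ω (weakPartial Ω j (weakPartial Ω j (u a))) :=
    fun j _ => ((hu a).2 j).memL2_weakPartial ho j
  have hgradDiv : ∀ j ∈ Finset.univ, MemL2 Ω (weakPartial Ω a (weakPartial Ω j (u j))) :=
    fun j _ => ((hu j).2 j).memL2_weakPartial ho a
  rw [l2Class_congr (lame_ae_eq lam mu ho hu a),
    l2Class_add ((memL2_sum _ hlap).const_smul _) ((memL2_sum _ hgradDiv).const_smul _),
    l2Class_const_smul _ (memL2_sum _ hlap), l2Class_const_smul _ (memL2_sum _ hgradDiv),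
    l2Class_sum _ hlap, l2Class_sum _ hgradDiv]

theorem MemH20Vec.memH2 (hu : MemH20Vec Ω u) (a : Fin 3) : MemH2 Ω (u a) := (hu a).1

theorem MemH20Vec.memH10 (hu : MemH20Vec Ω u) (a : Fin 3) : MemH10 Ω (u a) := (hu a).memH10

theorem MemH20Vec.sum_inner_lame (ho : IsOpen Ω) (hu : MemH20Vec Ω u) :
    ∑ a, inner ℂ (l2Class Ω (u a)) (l2Class Ω (lame lam mu Ω u a))
      = -(elasticEnergy lam mu Ω u : ℂ) := by
  simp only [l2Class_lame lam mu ho hu.memH2]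
  exact ElasticITP.sum_inner_lame (𝕜 := ℂ) (f := fun a => l2Class Ω (u a))
    (x := fun a i => l2Class Ω (weakPartial Ω i (u a)))
    (y := fun a i j => l2Class Ω (weakPartial Ω i (weakPartial Ω j (u a))))
    (fun a b i j => by
      rw [(hu.memH10 b).inner_weakPartial_left ho ((hu.memH2 a).2 j) i, neg_neg]) mu (lam + mu)

theorem MemH20Vec.min_sq_mul_hessNormSq_le (ho : IsOpen Ω) (hmu : 0 < mu)
    (hlm : 0 < lam + 2 * mu) (hu : MemH20Vec Ω u) :
    min mu (lam + 2 * mu) ^ 2 * hessNormSq Ω u ≤ vecNormSq Ω (lame lam mu Ω u) := by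
  simp only [vecNormSq, l2Class_lame lam mu ho hu.memH2]
  have hsum : lam + 2 * mu = mu + (lam + mu) := by ring
  rw [hsum] at hlm ⊢
  exact min_sq_mul_sum_norm_sq_le_sum_norm_lame_sq (𝕜 := ℂ)
    (y := fun a i j => l2Class Ω (weakPartial Ω i (weakPartial Ω j (u a))))
    (fun a i j => l2Class_congr ((hu.memH2 a).weakPartial_comm_ae_eq ho i j))
    (fun a b i j k l =>
      ((hu a).memH10_weakPartial ho j).inner_weakPartial_swap ho ((hu.memH2 b).2 l) i k) hmu hlm

theorem MemH20Vec.memL2_lame_add_smul (ho : IsOpen Ω) (hu : MemH20Vec Ω u) (t : ℂ) (a : Fin 3) :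
    MemL2 Ω ((lame lam mu Ω u + t • u) a) :=
  (memL2_lame lam mu ho hu.memH2 a).add ((hu.memH2 a).1.1.const_smul t)

theorem MemH20Vec.vecNormSq_lame_add_smul (ho : IsOpen Ω) (hu : MemH20Vec Ω u) (t : ℝ) :
    vecNormSq Ω (lame lam mu Ω u + (t : ℂ) • u)
      = vecNormSq Ω (lame lam mu Ω u) - 2 * t * elasticEnergy lam mu Ω u
        + t ^ 2 * vecNormSq Ω u := by
  have hre := congrArg Complex.re (hu.sum_inner_lame (lam := lam) (mu := mu) ho)
  rw [Complex.re_sum, Complex.neg_re, Complex.ofReal_re] at hre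
  have hexpand : ∀ a, ‖l2Class Ω ((lame lam mu Ω u + (t : ℂ) • u) a)‖ ^ 2
      = ‖l2Class Ω (lame lam mu Ω u a)‖ ^ 2
        + 2 * t * (inner ℂ (l2Class Ω (u a)) (l2Class Ω (lame lam mu Ω u a))).re
        + t ^ 2 * ‖l2Class Ω (u a)‖ ^ 2 := fun a => by
    have hL2 := (hu.memH2 a).1.1
    rw [Pi.add_apply, Pi.smul_apply,
      l2Class_add (memL2_lame lam mu ho hu.memH2 a) (hL2.const_smul _), l2Class_const_smul _ hL2]
    have h := norm_real_smul_add_real_smul_sq (𝕜 := ℂ) 1 t (l2Class Ω (lame lam mu Ω u a))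
      (l2Class Ω (u a))
    rw [inner_re_symm] at h
    simpa using h
  simp only [vecNormSq, hexpand, Finset.sum_add_distrib, ← Finset.mul_sum, hre]
  ring

end Lame

section Coercivity

variable {Ω : Set E3} {lam mu : ℝ} {u : VField}

/-- The lower bound `min(μ, λ + 2μ) λ₁(Ω)` for the Dirichlet eigenvalues of `-Δ*` on `Ω`. -/
def lameEigenvalueBound (lam mu : ℝ) (Ω : Set E3) : ℝ :=
  min mu (lam + 2 * mu) * firstDirichletEigenvalue Ω

theorem lameEigenvalueBound_mul_vecNormSq_le (hb : Bornology.IsBounded Ω) (ho : IsOpen Ω)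
    (hmu : 0 < mu) (hlm : 0 < lam + 2 * mu) (hu : ∀ a, MemH10 Ω (u a)) :
    lameEigenvalueBound lam mu Ω * vecNormSq Ω u ≤ elasticEnergy lam mu Ω u := by
  refine le_trans ?_ (min_mul_gradNormSq_le_elasticEnergy ho hu)
  rw [lameEigenvalueBound, mul_assoc]
  exact mul_le_mul_of_nonneg_left (firstDirichletEigenvalue_mul_vecNormSq_le hb ho hu)
    (lt_min hmu hlm).le

theorem MemH20Vec.sub_two_mul_add_sq_mul_nonneg (ho : IsOpen Ω) (hu : MemH20Vec Ω u) (t : ℝ) :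
    0 ≤ vecNormSq Ω (lame lam mu Ω u) - 2 * t * elasticEnergy lam mu Ω u
      + t ^ 2 * vecNormSq Ω u := by
  rw [← hu.vecNormSq_lame_add_smul ho]
  exact vecNormSq_nonneg _ _

theorem MemH20Vec.h2NormSqVec_le (hb : Bornology.IsBounded Ω) (ho : IsOpen Ω) (hmu : 0 < mu)
    (hlm : 0 < lam + 2 * mu) (hK : 0 < lameEigenvalueBound lam mu Ω) (hu : MemH20Vec Ω u) :
    h2NormSqVec Ω u ≤ (1 / lameEigenvalueBound lam mu Ω ^ 2
      + 1 / (lameEigenvalueBound lam mu Ω * min mu (lam + 2 * mu))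
      + 1 / min mu (lam + 2 * mu) ^ 2) * vecNormSq Ω (lame lam mu Ω u) := by
  have hN := lameEigenvalueBound_mul_vecNormSq_le hb ho hmu hlm hu.memH10
  have hG := min_mul_gradNormSq_le_elasticEnergy (lam := lam) (mu := mu) ho hu.memH10
  have hH := hu.min_sq_mul_hessNormSq_le ho hmu hlm
  have hX := hu.sub_two_mul_add_sq_mul_nonneg (lam := lam) (mu := mu) ho
    (lameEigenvalueBound lam mu Ω)
  have hm : 0 < min mu (lam + 2 * mu) := lt_min hmu hlm
  set K := lameEigenvalueBound lam mu Ω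
  set m := min mu (lam + 2 * mu)
  set D := elasticEnergy lam mu Ω u
  set X := vecNormSq Ω (lame lam mu Ω u)
  have hD : D ≤ X / K := by
    rw [le_div_iff₀ hK]
    nlinarith only [hX, mul_le_mul_of_nonneg_left hN hK.le]
  rw [h2NormSqVec_eq ho hu.memH2]
  calc vecNormSq Ω u + gradNormSq Ω u + hessNormSq Ω u
      ≤ D / K + D / m + X / m ^ 2 := by
        gcongr
        · rwa [le_div_iff₀' hK]
        · rwa [le_div_iff₀' hm]
        · rwa [le_div_iff₀' (by positivity)]
    _ ≤ X / K / K + X / K / m + X / m ^ 2 := by gcongr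
    _ = _ := by field_simp

theorem exists_mul_h2NormSqVec_le (hb : Bornology.IsBounded Ω) (ho : IsOpen Ω) (hmu : 0 < mu)
    (hlm : 0 < lam + 2 * mu) {a b : ℝ} (ha : 0 ≤ a) (haK : a < lameEigenvalueBound lam mu Ω)
    (hbK : b < lameEigenvalueBound lam mu Ω) :
    ∃ C : ℝ, 0 < C ∧ ∀ u : VField, MemH20Vec Ω u →
      C * h2NormSqVec Ω u ≤ vecNormSq Ω (lame lam mu Ω u)
        - (a + b) * elasticEnergy lam mu Ω u + a * b * vecNormSq Ω u := by
  have hK := ha.trans_lt haK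
  have : 0 < min mu (lam + 2 * mu) := lt_min hmu hlm
  set K := lameEigenvalueBound lam mu Ω
  set Q : ℝ := 1 / K ^ 2 + 1 / (K * min mu (lam + 2 * mu)) + 1 / min mu (lam + 2 * mu) ^ 2
  set c : ℝ := (1 - a / K) * (1 - max b 0 / K)
  have hQ : 0 < Q := by positivity
  have hb'K : max b 0 < K := max_lt hbK hK
  have hc : 0 < c :=
    mul_pos (sub_pos.2 ((div_lt_one hK).2 haK)) (sub_pos.2 ((div_lt_one hK).2 hb'K))
  refine ⟨c / Q, by positivity, fun u hu => ?_⟩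
  have hN := lameEigenvalueBound_mul_vecNormSq_le hb ho hmu hlm hu.memH10
  have haN : a * vecNormSq Ω u ≤ elasticEnergy lam mu Ω u :=
    (mul_le_mul_of_nonneg_right haK.le (vecNormSq_nonneg Ω u)).trans hN
  calc c / Q * h2NormSqVec Ω u ≤ c / Q * (Q * vecNormSq Ω (lame lam mu Ω u)) := by
        gcongr
        exact hu.h2NormSqVec_le hb ho hmu hlm hK
    _ = c * vecNormSq Ω (lame lam mu Ω u) := by field_simp
    _ ≤ vecNormSq Ω (lame lam mu Ω u) - (a + max b 0) * elasticEnergy lam mu Ω u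
        + a * max b 0 * vecNormSq Ω u :=
      quadratic_lower_bound hK ha haK.le (le_max_right _ _) hb'K.le hN
        (hu.sub_two_mul_add_sq_mul_nonneg ho K)
    _ ≤ _ := by nlinarith only [mul_nonneg (sub_nonneg.2 (le_max_left b 0)) (sub_nonneg.2 haN)]

theorem MemH20Vec.formA_self (ho : IsOpen Ω) (hu : MemH20Vec Ω u) (ρ : E3 → ℝ) (ω : ℝ) :
    formA lam mu Ω ρ ω u u
      = (((∫ x in Ω, (1 - ρ x)⁻¹ * ∑ a, ‖(lame lam mu Ω u + ((ω ^ 2 : ℝ) : ℂ) • u) a x‖ ^ 2)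
        + ω ^ 2 * elasticEnergy lam mu Ω u - ω ^ 4 * vecNormSq Ω u : ℝ) : ℂ) := by
  have hweight := integral_ofReal_mul_sum_mul_conj_self Ω (fun x => (1 - ρ x)⁻¹)
    (lame lam mu Ω u + ((ω ^ 2 : ℝ) : ℂ) • u)
  simp only [Pi.add_apply, Pi.smul_apply, smul_eq_mul, Complex.ofReal_pow] at hweight
  rw [formA, hweight, integral_moduli_eq_elasticEnergy ho hu.memH10,
    integral_sum_mul_conj_self fun a => (hu.memH2 a).1.1]
  simp only [Pi.add_apply, Pi.smul_apply, smul_eq_mul]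
  push_cast
  rfl

theorem exists_mul_h2NormSqVec_le_mul_re_formA (hb : Bornology.IsBounded Ω) (ho : IsOpen Ω)
    (hmu : 0 < mu) (hlm : 0 < lam + 2 * mu) {ρ : E3 → ℝ} {ω σ r B : ℝ}
    (hρ : AEMeasurable ρ (volume.restrict Ω)) (hr : 0 < σ * (1 - r)⁻¹)
    (hρr : ∀ᵐ x ∂(volume.restrict Ω), σ * (1 - r)⁻¹ ≤ σ * (1 - ρ x)⁻¹)
    (hρB : ∀ᵐ x ∂(volume.restrict Ω), σ * (1 - ρ x)⁻¹ ≤ B)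
    (hω : ω ^ 2 < lameEigenvalueBound lam mu Ω) (hωr : ω ^ 2 * r < lameEigenvalueBound lam mu Ω) :
    ∃ C : ℝ, 0 < C ∧ ∀ u : VField, MemH20Vec Ω u → (formA lam mu Ω ρ ω u u).im = 0 ∧
      C * h2NormSqVec Ω u ≤ σ * (formA lam mu Ω ρ ω u u).re := by
  obtain ⟨C, hC, hCu⟩ := exists_mul_h2NormSqVec_le hb ho hmu hlm (sq_nonneg ω) hω hωr
  refine ⟨σ * (1 - r)⁻¹ * C, by positivity, fun u hu => ?_⟩
  rw [hu.formA_self ho, Complex.ofReal_im, Complex.ofReal_re]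
  refine ⟨rfl, ?_⟩
  have hbound : ∀ᵐ x ∂(volume.restrict Ω), ‖σ * (1 - ρ x)⁻¹‖ ≤ B := by
    filter_upwards [hρr, hρB] with x hx hxB
    rwa [Real.norm_of_nonneg (hr.le.trans hx)]
  have hweight := mul_vecNormSq_le_integral
    (hu.memL2_lame_add_smul (lam := lam) (mu := mu) ho ((ω ^ 2 : ℝ) : ℂ))
    ((hρ.const_sub 1).inv.const_mul σ).aestronglyMeasurable hbound hρr
  simp only [Pi.inv_apply, mul_assoc σ _ (Finset.sum _ _), integral_const_mul] at hweight
  rw [hu.vecNormSq_lame_add_smul ho] at hweight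
  have hσ : σ * (1 - r)⁻¹ * (1 - r) = σ :=
    inv_mul_cancel_right₀ (fun h => by simp [h] at hr) σ
  set X := vecNormSq Ω (lame lam mu Ω u)
  set D := elasticEnergy lam mu Ω u
  set N := vecNormSq Ω u
  calc σ * (1 - r)⁻¹ * C * h2NormSqVec Ω u
      ≤ σ * (1 - r)⁻¹ * (X - (ω ^ 2 + ω ^ 2 * r) * D + ω ^ 2 * (ω ^ 2 * r) * N) := by
        rw [mul_assoc _ C]
        exact mul_le_mul_of_nonneg_left (hCu u hu) hr.le
    _ = σ * (1 - r)⁻¹ * (X - 2 * ω ^ 2 * D + (ω ^ 2) ^ 2 * N)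
        + σ * (1 - r)⁻¹ * (1 - r) * (ω ^ 2 * D - ω ^ 4 * N) := by ring
    _ ≤ _ := by
        rw [hσ]
        linarith only [hweight]

theorem ae_essInf_le_and_le_essSup {α : Type*} [MeasurableSpace α] {ν : Measure α} {f : α → ℝ}
    (hf : MemLp f ⊤ ν) : ∀ᵐ x ∂ν, essInf f ν ≤ f x ∧ f x ≤ essSup f ν := by
  have hbdd : ∀ᵐ x ∂ν, ‖f x‖ ≤ (eLpNorm f ⊤ ν).toReal := by
    filter_upwards [ae_le_eLpNormEssSup (f := f) (μ := ν)] with x hx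
    simpa using ENNReal.toReal_mono hf.eLpNorm_ne_top (hx.trans_eq eLpNorm_exponent_top.symm)
  have habove : IsBoundedUnder (· ≤ ·) (ae ν) f :=
    isBoundedUnder_of_eventually_le (hbdd.mono fun x hx => (abs_le.1 hx).2)
  have hbelow : IsBoundedUnder (· ≥ ·) (ae ν) f :=
    isBoundedUnder_of_eventually_ge (hbdd.mono fun x hx => (abs_le.1 hx).1)
  exact (ae_essInf_le hbelow).and (ae_le_essSup habove)

theorem essInf_le_essSup_of_memLp_top {α : Type*} [MeasurableSpace α] {ν : Measure α}
    [(ae ν).NeBot] {f : α → ℝ} (hf : MemLp f ⊤ ν) : essInf f ν ≤ essSup f ν :=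
  (ae_essInf_le_and_le_essSup hf).exists.elim fun _ hx => hx.1.trans hx.2

theorem ae_volume_restrict_neBot (ho : IsOpen Ω) (hne : Ω.Nonempty) :
    (ae (volume.restrict Ω)).NeBot :=
  ae_restrict_neBot.2 (ho.measure_pos volume hne).ne'

theorem min_mul_firstDirichletEigenvalue_le (ho : IsOpen Ω) (hmu : 0 ≤ mu) :
    min mu (3 * lam + 2 * mu) * firstDirichletEigenvalue Ω ≤ lameEigenvalueBound lam mu Ω := by
  have hmin : min mu (3 * lam + 2 * mu) ≤ lam + 2 * mu := by
    linarith [min_le_left mu (3 * lam + 2 * mu), min_le_right mu (3 * lam + 2 * mu)]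
  exact mul_le_mul_of_nonneg_right (le_min (min_le_left _ _) hmin)
    (firstDirichletEigenvalue_nonneg ho)

end Coercivity

end ElasticITP

end

open ElasticITP Filter in
theorem mainTheorem8_general
    (Ω : Set E3) (hΩ_open : IsOpen Ω) (hΩ_ne : Ω.Nonempty) (hΩ_bdd : Bornology.IsBounded Ω)
    (lam mu : ℝ) (hmu : 0 < mu) (hlam : 0 < lam + 2 * mu)
    (ρ : E3 → ℝ) (hρ_mem : MemLp ρ ⊤ (volume.restrict Ω)) (ω : ℝ) :
    (1 < essInf ρ (volume.restrict Ω) →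
      ω ^ 2 * essSup ρ (volume.restrict Ω) < lameEigenvalueBound lam mu Ω →
      ∃ C : ℝ, 0 < C ∧ ∀ u : VField, MemH20Vec Ω u → (formA lam mu Ω ρ ω u u).im = 0 ∧
        C * h2NormSqVec Ω u ≤ -(formA lam mu Ω ρ ω u u).re) ∧
    (essSup ρ (volume.restrict Ω) < 1 → ω ^ 2 < lameEigenvalueBound lam mu Ω →
      ∃ C : ℝ, 0 < C ∧ ∀ u : VField, MemH20Vec Ω u → (formA lam mu Ω ρ ω u u).im = 0 ∧
        C * h2NormSqVec Ω u ≤ (formA lam mu Ω ρ ω u u).re) := by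
  have := ae_volume_restrict_neBot hΩ_open hΩ_ne
  have hae := ae_essInf_le_and_le_essSup hρ_mem
  have hle := essInf_le_essSup_of_memLp_top hρ_mem
  set s := essInf ρ (volume.restrict Ω)
  set S := essSup ρ (volume.restrict Ω)
  constructor
  · intro hinf hω
    have hneg : ∀ t : ℝ, -1 * (1 - t)⁻¹ = (t - 1)⁻¹ := fun t => by
      rw [neg_one_mul, ← inv_neg, neg_sub]
    have hlower : ∀ᵐ x ∂(volume.restrict Ω), -1 * (1 - S)⁻¹ ≤ -1 * (1 - ρ x)⁻¹ := by
      filter_upwards [hae] with x hx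
      simpa only [hneg] using inv_anti₀ (by linarith) (by linarith)
    have hupper : ∀ᵐ x ∂(volume.restrict Ω), -1 * (1 - ρ x)⁻¹ ≤ (s - 1)⁻¹ := by
      filter_upwards [hae] with x hx
      simpa only [hneg] using inv_anti₀ (by linarith) (by linarith)
    have hω' : ω ^ 2 < lameEigenvalueBound lam mu Ω :=
      (le_mul_of_one_le_right (sq_nonneg ω) (hinf.le.trans hle)).trans_lt hω
    simpa only [neg_one_mul] using exists_mul_h2NormSqVec_le_mul_re_formA hΩ_bdd hΩ_open hmu hlam
      hρ_mem.1.aemeasurable (by rw [hneg]; exact inv_pos.2 (by linarith)) hlower hupper hω' hω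
  · intro hsup hω
    have hlower : ∀ᵐ x ∂(volume.restrict Ω), 1 * (1 - s)⁻¹ ≤ 1 * (1 - ρ x)⁻¹ := by
      filter_upwards [hae] with x hx
      simpa only [one_mul] using inv_anti₀ (by linarith) (by linarith)
    have hupper : ∀ᵐ x ∂(volume.restrict Ω), 1 * (1 - ρ x)⁻¹ ≤ (1 - S)⁻¹ := by
      filter_upwards [hae] with x hx
      simpa only [one_mul] using inv_anti₀ (by linarith) (by linarith)
    have hω' : ω ^ 2 * s < lameEigenvalueBound lam mu Ω :=
      (mul_le_of_le_one_right (sq_nonneg ω) (hle.trans hsup.le)).trans_lt hω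
    simpa only [one_mul] using exists_mul_h2NormSqVec_le_mul_re_formA hΩ_bdd hΩ_open hmu hlam
      hρ_mem.1.aemeasurable (by rw [one_mul]; exact inv_pos.2 (by linarith)) hlower hupper hω hω'

theorem mainTheorem8
    (Ω : Set ElasticITP.E3) (hΩ_open : IsOpen Ω) (hΩ_ne : Ω.Nonempty)
    (hΩ_bdd : Bornology.IsBounded Ω)
    (lam mu : ℝ) (hmu : 0 < mu) (hlam : 0 < 3 * lam + 2 * mu)
    (ρ : ElasticITP.E3 → ℝ) (hρ_mem : MemLp ρ ⊤ (volume.restrict Ω))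
    (hρ_pos : ∀ᵐ x ∂(volume.restrict Ω), 0 < ρ x)
    (ω : ℝ) (hω_pos : 0 < ω ^ 2)
    (hω_lt : ω ^ 2 < min
      (min mu (3 * lam + 2 * mu) * ElasticITP.firstDirichletEigenvalue Ω
        / essSup ρ (volume.restrict Ω))
      (min mu (3 * lam + 2 * mu) * ElasticITP.firstDirichletEigenvalue Ω)) :
    (1 < essInf ρ (volume.restrict Ω) →
      ∃ C : ℝ, 0 < C ∧ ∀ u : ElasticITP.VField, ElasticITP.MemH20Vec Ω u →
        (ElasticITP.formA lam mu Ω ρ ω u u).im = 0 ∧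
        C * ElasticITP.h2NormSqVec Ω u ≤ -(ElasticITP.formA lam mu Ω ρ ω u u).re) ∧
    (essSup ρ (volume.restrict Ω) < 1 →
      ∃ C : ℝ, 0 < C ∧ ∀ u : ElasticITP.VField, ElasticITP.MemH20Vec Ω u →
        (ElasticITP.formA lam mu Ω ρ ω u u).im = 0 ∧
        C * ElasticITP.h2NormSqVec Ω u ≤ (ElasticITP.formA lam mu Ω ρ ω u u).re) := by
  have := ElasticITP.ae_volume_restrict_neBot hΩ_open hΩ_ne
  have hle := ElasticITP.min_mul_firstDirichletEigenvalue_le (lam := lam) hΩ_open hmu.le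
  obtain ⟨hω_div, hω⟩ := lt_min_iff.1 hω_lt
  refine (mainTheorem8_general Ω hΩ_open hΩ_ne hΩ_bdd lam mu hmu (by linarith) ρ hρ_mem ω).imp
    (fun h hinf => h hinf ?_) (fun h hsup => h hsup (hω.trans_le hle))
  have hsup := one_pos.trans (hinf.trans_le (ElasticITP.essInf_le_essSup_of_memLp_top hρ_mem))
  exact ((lt_div_iff₀ hsup).1 hω_div).trans_le hle
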